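/- **Setting.** Let $\mathbb V$ (variables) and $\mathbb F$ (factors) be finite sets, where each factor $a\in\mathbb F$ is a set of variables (two different factors may consist of the same variables). Let $\phi_i:\{1,\dots,q\}\to(0,\infty)$ for $i\in\mathbb V$ and $\psi_a:\{1,\dots,q\}^a\to(0,\infty)$ for $a\in\mathbb F$. Assume that the bipartite factor graph, with edge set $\mathbb E=\{ai : i\in a\}$, is connected. For messages $m=(m_{a\to i}(k))_{ai\in\mathbb E,\,1\le k\le q}$ put $$n_{j\to a}(k)=\phi_j(k)\prod_{a'\ni j,\,a'\neq a}m_{a'\to j}(k),\qquad \Theta_{ai,k}(m)=\sum_{x_a:\,x_i=k}\psi_a(x_a)\prod_{j\in a\setminus i}n_{j\to a}(x_j),$$ and let $F_{ai,k}(m)=\Theta_{ai,k}(m)/Z^{\mathrm{mess}}_{ai}(m)$ with $Z^{\mathrm{mess}}_{ai}(m)=\sum_{x=1}^q\Theta_{ai,x}(m)$ be the (parallel) belief propagation update normalized by $Z^{\mathrm{mess}}$. Let $m$ be a fixed point of $F$ with positive entries. Its beliefs are the probability distributions $b_i(k)\propto\phi_i(k)\prod_{a\ni i}m_{a\to i}(k)$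 and $b_a(x_a)\propto\psi_a(x_a)\prod_{i\in a}n_{i\to a}(x_i)$. For $i\ne j$ in a common factor $a$ let $B^{(iaj)}$ be the stochastic $q\times q$ matrix with entries $$b^{(iaj)}_{k\ell}=b_a(x_j=\ell\mid x_i=k)=\sum_{x_a:\,x_i=k,\,x_j=\ell}\frac{b_a(x_a)}{b_i(k)},$$ let $K^{(iaj)}=B^{(iaj)}B^{(jai)}$ (a reversible stochastic kernel), let $\mu_2^{(iaj)}$ be the second largest eigenvalue of $K^{(iaj)}$, counted with multiplicity, and let $\mu_2=\max|\mu_2^{(iaj)}|^{1/2}$ over all such $(i,a,j)$. (A missing second eigenvalue and a maximum over the empty set are read as $0$.) Let $A$ be the adjacency matrix of the oriented line graph, $A_{ai}^{a'j}=1$ if $j\in a\cap a'$, $j\ne i$ and $a'\neq a$, and $A_{ai}^{a'j}=0$ otherwise, and let $\lambda_1$ be its Perron eigenvalue, i.e. its spectral radius. Call $m$ *linearly stable* if $F$ is differentiable at $m$ and its Jacobian matrix at $m$ has spectral radius strictly less than $1$. Call $m$ *Lyapunov stable* if for every neighbourhood $U$ of $m$ all orbits $(F^n(y))_{n\ge0}$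 with $y$ close enough to $m$ stay in $U$, and *locally asymptotically stable* if moreover $F^n(y)\to m$ for all $y$ in a neighbourhood of $m$. **Theorem.** (i) If $\lambda_1\mu_2<1$, then $m$ is linearly stable and locally asymptotically stable. (ii) Suppose that the system is homogeneous: $B^{(iaj)}=B$ for all $i\neq j$ in a common factor $a$. Let $|\mu_2(B)|$ be the modulus of the second largest eigenvalue of $B$, where the eigenvalues are ordered by modulus and counted with multiplicity. Then $m$ is linearly stable if and only if $\lambda_1|\mu_2(B)|<1$. Moreover, $m$ is locally asymptotically stable if $\lambda_1|\mu_2(B)|<1$, and it is not even Lyapunov stable if $\lambda_1|\mu_2(B)|>1$. -/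

import Mathlib

open Filter Topology

noncomputable section

namespace BP

/-- The bipartite factor graph attached to a family of factors: `a` is the factor whose set of
variables is `scope a`, and it is linked to the variables in `scope a`. -/
def factorGraph {V F : Type*} (scope : F → Finset V) : SimpleGraph (F ⊕ V) :=
  SimpleGraph.fromRel fun x y => ∃ a i, x = Sum.inl a ∧ y = Sum.inr i ∧ i ∈ scope a

/-- A Markov random field `p(x) ∝ ∏ i, φ i (x i) * ∏ a, ψ a (x_a)` with variables `i : V` taking
`q` values, factors `a : F`, positive local functions and a connected factor graph. Two different
factors may have the same set of variables. -/
structure MarkovField (V F : Type*) (q : ℕ) where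
  scope : F → Finset V
  phi : V → Fin q → ℝ
  psi : (a : F) → (scope a → Fin q) → ℝ
  phi_pos : ∀ i k, 0 < phi i k
  psi_pos : ∀ a x, 0 < psi a x
  connected : (factorGraph scope).Connected

variable {V F : Type*} [Fintype V] [DecidableEq V] [Fintype F] [DecidableEq F] {q : ℕ}

/-- The edges `ai` of the factor graph, that is the pairs `(a, i)` with `i ∈ a`. -/
abbrev MarkovField.Edge (M : MarkovField V F q) : Type _ :=
  {e : F × V // e.2 ∈ M.scope e.1}

/-- A set of messages: `m (ai, k)` is `m_{a → i}(k)`. -/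
abbrev MarkovField.Messages (M : MarkovField V F q) : Type _ :=
  M.Edge × Fin q → ℝ

/-- `n_{j → a}(k) = φ_j(k) ∏_{a' ∋ j, a' ≠ a} m_{a' → j}(k)`. -/
def MarkovField.varMessage (M : MarkovField V F q) (m : M.Messages) (j : V) (a : F)
    (k : Fin q) : ℝ :=
  M.phi j k * ∏ e : M.Edge with e.1.2 = j ∧ e.1.1 ≠ a, m (e, k)

/-- The plain BP update
`Θ_{ai,k}(m) = ∑_{x_a : x_i = k} ψ_a(x_a) ∏_{j ∈ a \ i} n_{j → a}(x_j)`. -/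
def MarkovField.plainUpdate (M : MarkovField V F q) (m : M.Messages) : M.Messages :=
  fun p => ∑ x : M.scope p.1.1.1 → Fin q with x ⟨p.1.1.2, p.1.2⟩ = p.2,
    M.psi p.1.1.1 x *
      ∏ j : M.scope p.1.1.1 with j ≠ ⟨p.1.1.2, p.1.2⟩, M.varMessage m j p.1.1.1 (x j)

/-- `Z^mess_{ai}(m) = ∑_x Θ_{ai,x}(m)`. -/
def MarkovField.Zmess (M : MarkovField V F q) (m : M.Messages) (e : M.Edge) : ℝ :=
  ∑ k, M.plainUpdate m (e, k)

/-- The (parallel) update of BP normalized by `Z^mess`. -/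
def MarkovField.normUpdate (M : MarkovField V F q) (m : M.Messages) : M.Messages :=
  fun p => M.plainUpdate m p / M.Zmess m p.1

/-- The single node belief `b_i(k) = φ_i(k) ∏_{a ∋ i} m_{a → i}(k) / Z_i(m)`. -/
def MarkovField.varBelief (M : MarkovField V F q) (m : M.Messages) (i : V) (k : Fin q) : ℝ :=
  (M.phi i k * ∏ e : M.Edge with e.1.2 = i, m (e, k)) /
    ∑ l, M.phi i l * ∏ e : M.Edge with e.1.2 = i, m (e, l)

/-- The factor belief `b_a(x_a) = ψ_a(x_a) ∏_{i ∈ a} n_{i → a}(x_i) / Z_a(m)`. -/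
def MarkovField.factorBelief (M : MarkovField V F q) (m : M.Messages) (a : F)
    (x : M.scope a → Fin q) : ℝ :=
  (M.psi a x * ∏ i : M.scope a, M.varMessage m i a (x i)) /
    ∑ y : M.scope a → Fin q, M.psi a y * ∏ i : M.scope a, M.varMessage m i a (y i)

/-- The matrix `B^{(iaj)}` of conditional beliefs
`b_a(x_j = l | x_i = k) = ∑_{x_a : x_i = k, x_j = l} b_a(x_a) / b_i(k)`. -/
def MarkovField.condBelief (M : MarkovField V F q) (m : M.Messages) (a : F) (i j : M.scope a) :
    Matrix (Fin q) (Fin q) ℝ :=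
  Matrix.of fun k l =>
    ∑ x : M.scope a → Fin q with x i = k ∧ x j = l, M.factorBelief m a x / M.varBelief m i k

/-- The adjacency matrix `A` of the oriented line graph, which links `ai` to `a'j` when
`j ∈ a ∩ a'`, `j ≠ i` and `a' ≠ a`. -/
def MarkovField.lineAdj (M : MarkovField V F q) : Matrix M.Edge M.Edge ℝ :=
  Matrix.of fun e e' =>
    if e'.1.2 ∈ M.scope e.1.1 ∧ e'.1.2 ≠ e.1.2 ∧ e'.1.1 ≠ e.1.1 then 1 else 0

/-- The spectral radius of a real square matrix: the largest modulus of a complex eigenvalue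
(`0` for the empty matrix). -/
def matrixRadius {ι : Type*} [Fintype ι] [DecidableEq ι] (X : Matrix ι ι ℝ) : ℝ :=
  (spectralRadius ℂ (X.map (algebraMap ℝ ℂ))).toReal

/-- The Perron eigenvalue `λ₁` of the nonnegative matrix `A`, i.e. its spectral radius. -/
def MarkovField.perron (M : MarkovField V F q) : ℝ :=
  matrixRadius M.lineAdj

/-- The second largest element of a multiset of real numbers, elements being repeated according to
their multiplicity (`0` if there are fewer than two elements). -/
def secondLargest (s : Multiset ℝ) : ℝ :=
  (s.sort (· ≥ ·)).getD 1 0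

/-- The second largest eigenvalue, with multiplicity, of a matrix with real spectrum. -/
def secondEigenvalue (X : Matrix (Fin q) (Fin q) ℝ) : ℝ :=
  secondLargest X.charpoly.roots

/-- The modulus of the second largest eigenvalue in modulus, with multiplicity, of a matrix with
real spectrum. -/
def secondEigenvalueAbs (X : Matrix (Fin q) (Fin q) ℝ) : ℝ :=
  secondLargest (X.charpoly.roots.map fun t => |t|)

/-- `μ₂`, the maximum of `|μ₂^{(iaj)}|^{1/2}` over the pairs of distinct variables `i`, `j` of a
common factor `a`, where `μ₂^{(iaj)}` is the second largest eigenvalue of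
`K^{(iaj)} = B^{(iaj)} B^{(jai)}`; it is `0` if there is no such pair. -/
def MarkovField.mu2 (M : MarkovField V F q) (m : M.Messages) : ℝ :=
  ⨆ p : (a : F) × {p : M.scope a × M.scope a // p.1 ≠ p.2},
    √|secondEigenvalue
      (M.condBelief m p.1 p.2.1.1 p.2.1.2 * M.condBelief m p.1 p.2.1.2 p.2.1.1)|

/-- All the `B^{(iaj)}` with `i ≠ j` are equal to `B`. -/
def MarkovField.Homogeneous (M : MarkovField V F q) (m : M.Messages)
    (B : Matrix (Fin q) (Fin q) ℝ) : Prop :=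
  ∀ (a : F) (i j : M.scope a), i ≠ j → M.condBelief m a i j = B

/-- Linear stability of `x` for `f`: `f` is differentiable at `x` and the Jacobian matrix of `f`
at `x` has spectral radius strictly smaller than `1`. -/
def LinearlyStable {ι : Type*} [Fintype ι] [DecidableEq ι] (f : (ι → ℝ) → ι → ℝ) (x : ι → ℝ) :
    Prop :=
  DifferentiableAt ℝ f x ∧ matrixRadius (LinearMap.toMatrix' (fderiv ℝ f x).toLinearMap) < 1

/-- Lyapunov stability of `x` for the iteration of `f`. -/
def LyapunovStable {X : Type*} [TopologicalSpace X] (f : X → X) (x : X) : Prop :=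
  ∀ U ∈ 𝓝 x, ∀ᶠ y in 𝓝 x, ∀ n : ℕ, f^[n] y ∈ U

/-- Local asymptotic stability of `x` for the iteration of `f`. -/
def LocallyAsymptoticallyStable {X : Type*} [TopologicalSpace X] (f : X → X) (x : X) : Prop :=
  LyapunovStable f x ∧ ∀ᶠ y in 𝓝 x, Tendsto (fun n : ℕ => f^[n] y) atTop (𝓝 x)

end BP

end

/-! Perturb the messages multiplicatively, `δm = m * g`. At a fixed point the derivative of `log Θ`
sends `g` to the matrix with blocks `A_{ai}^{a'j} B^{(iaj)}` applied to `g`, because the conditional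
beliefs are exactly the weights produced by the logarithmic derivative (`condBelief_eq`). Dividing
by `Z^mess` subtracts, on each edge, the mean against `m`. So only functions modulo constants on
each edge matter, and `B^{(iaj)}` may be replaced by `B^{(iaj)} - 1 b_jᵀ` without changing the
spectral radius (`matrixRadius_fderiv_normUpdate`).

By detailed balance, `B^{(iaj)}` and `B^{(jai)}` are adjoint between `L²(b_j)` and `L²(b_i)`. The
squared norm of a centered block is therefore the second eigenvalue of `B^{(jai)} B^{(iaj)}`
(`norm_sq_sqrt_conj_centered`), and the powers of the Jacobian are dominated blockwise by those of
`μ₂ A` (`norm_block_pow_le`). This gives (i). In the homogeneous case `B` is reversible with a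
unique reversing distribution `w`, so the centered Jacobian is the Kronecker product of `A` and `B -
1 wᵀ`, and its radius is exactly `λ₁ |μ₂(B)|`.

The dynamics follow from the radius of the Jacobian. Below `1`, some iterate contracts towards the
fixed point. Above `1`, an orbit started along a leading eigenvector follows the linear growth up to
a quadratic error until it leaves a fixed ball (`not_lyapunovStable_of_one_lt_matrixRadius`). -/

namespace BP

set_option linter.unusedSectionVars false

/-! ### Spectral radius of real matrices and Gelfand's formula. -/

section Radius

open scoped Matrix Matrix.Norms.Operator NNReal ENNReal

variable {ι κ : Type*} [Fintype ι] [DecidableEq ι] [Fintype κ] [DecidableEq κ]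

theorem matrixRadius_nonneg (X : Matrix ι ι ℝ) : 0 ≤ matrixRadius X := ENNReal.toReal_nonneg

theorem mem_spectrum_map_iff (X : Matrix ι ι ℝ) (z : ℂ) :
    z ∈ spectrum ℂ (X.map (algebraMap ℝ ℂ)) ↔ (X.charpoly.map (algebraMap ℝ ℂ)).IsRoot z := by
  rw [Matrix.mem_spectrum_iff_isRoot_charpoly, Matrix.charpoly_map]

/-- The spectral radius of a real matrix only depends on its characteristic polynomial. -/
theorem matrixRadius_eq_of_charpoly_eq {X : Matrix ι ι ℝ} {Y : Matrix κ κ ℝ}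
    (h : X.charpoly = Y.charpoly) : matrixRadius X = matrixRadius Y := by
  have : spectrum ℂ (X.map (algebraMap ℝ ℂ)) = spectrum ℂ (Y.map (algebraMap ℝ ℂ)) := by
    ext z
    rw [mem_spectrum_map_iff, mem_spectrum_map_iff, h]
  simp only [matrixRadius, spectralRadius, this]

theorem matrixRadius_mul_comm (X Y : Matrix ι ι ℝ) :
    matrixRadius (X * Y) = matrixRadius (Y * X) :=
  matrixRadius_eq_of_charpoly_eq (Matrix.charpoly_mul_comm X Y)

theorem diagonal_inv_mul_diagonal {d : ι → ℝ} (hd : ∀ i, d i ≠ 0) :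
    Matrix.diagonal (fun i => (d i)⁻¹) * Matrix.diagonal d = 1 := by
  rw [Matrix.diagonal_mul_diagonal, ← Matrix.diagonal_one]
  congr 1
  ext i
  exact inv_mul_cancel₀ (hd i)

theorem charpoly_diagonal_conj {d : ι → ℝ} (hd : ∀ i, d i ≠ 0) (X : Matrix ι ι ℝ) :
    (Matrix.diagonal d * X * Matrix.diagonal (fun i => (d i)⁻¹)).charpoly = X.charpoly := by
  rw [Matrix.charpoly_mul_comm, ← mul_assoc, diagonal_inv_mul_diagonal hd, one_mul]

theorem matrixRadius_diagonal_conj {d : ι → ℝ} (hd : ∀ i, d i ≠ 0) (X : Matrix ι ι ℝ) :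
    matrixRadius (Matrix.diagonal d * X * Matrix.diagonal (fun i => (d i)⁻¹)) = matrixRadius X :=
  matrixRadius_eq_of_charpoly_eq (charpoly_diagonal_conj hd X)

theorem spectralRadius_ne_top (X : Matrix ι ι ℂ) : spectralRadius ℂ X ≠ ∞ := by
  have h := spectrum.spectralRadius_le_pow_nnnorm_pow_one_div ℂ X 0
  simp only [zero_add, pow_one, Nat.cast_zero, div_one, ENNReal.rpow_one] at h
  exact ne_top_of_le_ne_top (ENNReal.mul_ne_top ENNReal.coe_ne_top ENNReal.coe_ne_top) h

theorem map_complex_pow (X : Matrix ι ι ℝ) (n : ℕ) :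
    (X ^ n).map (algebraMap ℝ ℂ) = X.map (algebraMap ℝ ℂ) ^ n :=
  Matrix.map_pow X (algebraMap ℝ ℂ) n

theorem nnnorm_map_complex (X : Matrix ι ι ℝ) : ‖X.map (algebraMap ℝ ℂ)‖₊ = ‖X‖₊ := by
  simp [Matrix.linfty_opNNNorm_def]

theorem norm_map_complex (X : Matrix ι ι ℝ) : ‖X.map (algebraMap ℝ ℂ)‖ = ‖X‖ :=
  congrArg NNReal.toReal (nnnorm_map_complex X)

/-- Gelfand's formula for a real matrix. -/
theorem tendsto_matrixRadius (X : Matrix ι ι ℝ) :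
    Tendsto (fun n : ℕ => ‖X ^ n‖ ^ (1 / n : ℝ)) atTop (𝓝 (matrixRadius X)) := by
  have h := spectrum.pow_nnnorm_pow_one_div_tendsto_nhds_spectralRadius
    (X.map (algebraMap ℝ ℂ))
  have h2 := (ENNReal.tendsto_toReal (spectralRadius_ne_top _)).comp h
  refine h2.congr fun n => ?_
  simp only [Function.comp, ← ENNReal.toReal_rpow, ENNReal.coe_toReal, coe_nnnorm,
    ← map_complex_pow, norm_map_complex]

theorem exists_norm_pow_le {X : Matrix ι ι ℝ} {s : ℝ} (hs : matrixRadius X < s) :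
    ∃ C : ℝ, 0 ≤ C ∧ ∀ n : ℕ, ‖X ^ n‖ ≤ C * s ^ n := by
  have hs0 : 0 < s := (matrixRadius_nonneg X).trans_lt hs
  have h1 : ∀ᶠ n : ℕ in atTop, ‖X ^ n‖ ≤ 1 * s ^ n := by
    filter_upwards [(tendsto_matrixRadius X).eventually_lt_const hs, eventually_gt_atTop 0]
      with n hn h0
    have := Real.rpow_le_rpow (Real.rpow_nonneg (norm_nonneg _) _) hn.le (Nat.cast_nonneg n)
    rwa [← Real.rpow_mul (norm_nonneg _), one_div,
      inv_mul_cancel₀ (Nat.cast_ne_zero.mpr h0.ne'), Real.rpow_one, Real.rpow_natCast,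
      ← one_mul (s ^ n)] at this
  obtain ⟨N, hN⟩ := eventually_atTop.mp h1
  -- The sum absorbs the finitely many exponents below `N`, where Gelfand's bound is not yet
  -- available.
  refine ⟨1 + ∑ n ∈ Finset.range N, ‖X ^ n‖ / s ^ n, by positivity, fun n => ?_⟩
  rcases le_or_gt N n with h | h
  · refine (hN n h).trans ?_
    gcongr
    exact le_add_of_nonneg_right (by positivity)
  · have := Finset.single_le_sum (f := fun n => ‖X ^ n‖ / s ^ n) (fun i _ => by positivity)
      (Finset.mem_range.mpr h)
    rw [← div_le_iff₀ (by positivity)]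
    linarith

/-- Gelfand's formula along the multiples of `n`, with `‖X ^ (n * k)‖ ≤ ‖X ^ n‖ ^ k`. -/
theorem matrixRadius_lt_one_of_norm_pow_lt_one {X : Matrix ι ι ℝ} {n : ℕ} (hn : n ≠ 0)
    (h : ‖X ^ n‖ < 1) : matrixRadius X < 1 := by
  have key : Tendsto (fun k : ℕ => ‖X ^ (n * k)‖ ^ (1 / (n * k : ℕ) : ℝ)) atTop
      (𝓝 (matrixRadius X)) :=
    (tendsto_matrixRadius X).comp (tendsto_id.const_mul_atTop' (Nat.pos_of_ne_zero hn))
  have hc : ‖X ^ n‖ ^ (1 / n : ℝ) < 1 :=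
    Real.rpow_lt_one (norm_nonneg _) h (by positivity)
  refine lt_of_le_of_lt (le_of_tendsto key ?_) hc
  filter_upwards [eventually_gt_atTop 0] with k hk
  rw [pow_mul]
  calc ‖(X ^ n) ^ k‖ ^ (1 / (n * k : ℕ) : ℝ) ≤ (‖X ^ n‖ ^ k) ^ (1 / (n * k : ℕ) : ℝ) := by
        gcongr
        exact norm_pow_le' _ hk
    _ = ‖X ^ n‖ ^ (1 / n : ℝ) := by
        rw [← Real.rpow_natCast, ← Real.rpow_mul (norm_nonneg _)]
        congr 1
        push_cast
        field_simp

theorem tendsto_pow_of_matrixRadius_lt_one {X : Matrix ι ι ℝ} (h : matrixRadius X < 1) :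
    Tendsto (fun n : ℕ => ‖X ^ n‖) atTop (𝓝 0) := by
  obtain ⟨s, h1, h2⟩ := exists_between h
  obtain ⟨C, -, hC⟩ := exists_norm_pow_le h1
  have hs0 : 0 ≤ s := (matrixRadius_nonneg X).trans h1.le
  refine squeeze_zero (fun n => norm_nonneg _) hC ?_
  simpa using (tendsto_pow_atTop_nhds_zero_of_lt_one hs0 h2).const_mul C

open Kronecker in
theorem nnnorm_kronecker (X : Matrix ι ι ℝ) (Y : Matrix κ κ ℝ) : ‖X ⊗ₖ Y‖₊ = ‖X‖₊ * ‖Y‖₊ := by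
  have : ∀ p : ι × κ, ∑ r : ι × κ, ‖X p.1 r.1‖₊ * ‖Y p.2 r.2‖₊ =
      (∑ j, ‖X p.1 j‖₊) * ∑ l, ‖Y p.2 l‖₊ := fun p => by
    rw [Fintype.sum_mul_sum, Fintype.sum_prod_type]
  rw [Matrix.linfty_opNNNorm_def, Matrix.linfty_opNNNorm_def, Matrix.linfty_opNNNorm_def,
    NNReal.finset_sup_mul, ← Finset.univ_product_univ, Finset.sup_product_left]
  refine Finset.sup_congr rfl fun i _ => ?_
  rw [NNReal.mul_finset_sup]
  refine Finset.sup_congr rfl fun k _ => ?_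
  rw [← this (i, k)]
  refine Finset.sum_congr rfl fun r _ => ?_
  exact nnnorm_mul _ _

open Kronecker in
theorem kronecker_pow (X : Matrix ι ι ℝ) (Y : Matrix κ κ ℝ) (n : ℕ) :
    (X ⊗ₖ Y) ^ n = (X ^ n) ⊗ₖ (Y ^ n) := by
  induction n with
  | zero => simp
  | succ n ih => rw [pow_succ, ih, ← Matrix.mul_kronecker_mul, ← pow_succ, ← pow_succ]

open Kronecker in
-- The maximal row sum norm is multiplicative on Kronecker products, and so are powers; Gelfand's
-- formula passes this to the radius without any eigenvector analysis.
theorem matrixRadius_kronecker (X : Matrix ι ι ℝ) (Y : Matrix κ κ ℝ) :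
    matrixRadius (X ⊗ₖ Y) = matrixRadius X * matrixRadius Y := by
  refine tendsto_nhds_unique (tendsto_matrixRadius _)
    (((tendsto_matrixRadius X).mul (tendsto_matrixRadius Y)).congr fun n => ?_)
  rw [kronecker_pow, ← Real.mul_rpow (norm_nonneg _) (norm_nonneg _)]
  congr 1
  exact (congrArg NNReal.toReal (nnnorm_kronecker (X ^ n) (Y ^ n))).symm

theorem abs_entry_le_norm (X : Matrix ι κ ℝ) (i : ι) (j : κ) : |X i j| ≤ ‖X‖ := by
  have h1 : ‖X i j‖₊ ≤ ∑ l, ‖X i l‖₊ :=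
    Finset.single_le_sum (f := fun l => ‖X i l‖₊) (fun _ _ => zero_le) (Finset.mem_univ j)
  have h2 : ∑ l, ‖X i l‖₊ ≤ ‖X‖₊ := by
    rw [Matrix.linfty_opNNNorm_def]
    exact Finset.le_sup (f := fun i => ∑ l, ‖X i l‖₊) (Finset.mem_univ i)
  exact_mod_cast h1.trans h2

theorem matrixRadius_lt_one_of_tendsto {X : Matrix ι ι ℝ}
    (h : ∀ i j, Tendsto (fun n : ℕ => (X ^ n) i j) atTop (𝓝 0)) : matrixRadius X < 1 := by
  have h' : Tendsto (fun n : ℕ => X ^ n) atTop (𝓝 0) :=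
    tendsto_pi_nhds.mpr fun i => tendsto_pi_nhds.mpr fun j => h i j
  have h1 := (tendsto_zero_iff_norm_tendsto_zero.mp h').eventually_lt_const one_pos
  obtain ⟨n, hn, h0⟩ := (h1.and (eventually_gt_atTop 0)).exists
  exact matrixRadius_lt_one_of_norm_pow_lt_one h0.ne' hn

theorem matrixRadius_smul {c : ℝ} (hc : 0 ≤ c) (X : Matrix ι ι ℝ) :
    matrixRadius (c • X) = c * matrixRadius X := by
  refine tendsto_nhds_unique (tendsto_matrixRadius _)
    (((tendsto_matrixRadius X).const_mul c).congr' ?_)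
  filter_upwards [eventually_gt_atTop 0] with n hn
  rw [smul_pow, norm_smul, Real.mul_rpow (norm_nonneg _) (norm_nonneg _), norm_pow c, one_div,
    Real.pow_rpow_inv_natCast (norm_nonneg _) hn.ne', Real.norm_of_nonneg hc]

theorem matrixRadius_zero : matrixRadius (0 : Matrix ι ι ℝ) = 0 := by
  have h := matrixRadius_smul le_rfl (0 : Matrix ι ι ℝ)
  rwa [zero_smul, zero_mul] at h

theorem abs_root_le_matrixRadius {X : Matrix ι ι ℝ} {t : ℝ} (ht : t ∈ X.charpoly.roots) :
    |t| ≤ matrixRadius X := by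
  have h1 : (t : ℂ) ∈ spectrum ℂ (X.map (algebraMap ℝ ℂ)) := by
    rw [mem_spectrum_map_iff]
    exact (Polynomial.isRoot_of_mem_roots ht).map (f := algebraMap ℝ ℂ)
  have h2 : (‖(t : ℂ)‖₊ : ℝ≥0∞) ≤ spectralRadius ℂ (X.map (algebraMap ℝ ℂ)) :=
    le_iSup₂ (f := fun k (_ : k ∈ spectrum ℂ (X.map (algebraMap ℝ ℂ))) => (‖k‖₊ : ℝ≥0∞)) _ h1
  have h3 := ENNReal.toReal_mono (spectralRadius_ne_top _) h2
  simpa [matrixRadius] using h3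

/-- The radius runs over complex eigenvalues; splitting over `ℝ` guarantees that the real roots are
all of them. -/
theorem matrixRadius_le_of_splits {X : Matrix ι ι ℝ} (hX : X.charpoly.Splits) {c : ℝ}
    (hc : 0 ≤ c) (h : ∀ t ∈ X.charpoly.roots, |t| ≤ c) : matrixRadius X ≤ c := by
  refine ENNReal.toReal_le_of_le_ofReal hc (iSup₂_le fun z hz => ?_)
  rw [mem_spectrum_map_iff] at hz
  have hne : X.charpoly.map (algebraMap ℝ ℂ) ≠ 0 :=
    (X.charpoly_monic.map (algebraMap ℝ ℂ)).ne_zero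
  have hz' := (Polynomial.mem_roots hne).mpr hz
  rw [hX.roots_map] at hz'
  obtain ⟨t, ht, rfl⟩ := Multiset.mem_map.mp hz'
  rw [← enorm_eq_nnnorm, ← ofReal_norm]
  refine ENNReal.ofReal_le_ofReal ?_
  simpa using h t ht

/-- A complex eigenvector for the spectral radius. -/
theorem exists_eigenvector_norm_eq_matrixRadius [Nonempty ι] (X : Matrix ι ι ℝ) :
    ∃ (z : ℂ) (v : ι → ℂ), ‖z‖ = matrixRadius X ∧ v ≠ 0 ∧
      (X.map (algebraMap ℝ ℂ)).mulVec v = z • v := by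
  obtain ⟨z, hz, hr⟩ := spectrum.exists_nnnorm_eq_spectralRadius (X.map (algebraMap ℝ ℂ))
  have hz' := hz
  rw [← Matrix.spectrum_toLin', ← Module.End.hasEigenvalue_iff_mem_spectrum] at hz'
  obtain ⟨v, hv⟩ := hz'.exists_hasEigenvector
  refine ⟨z, v, ?_, hv.2, by simpa using hv.apply_eq_smul⟩
  rw [matrixRadius, ← hr]
  simp

end Radius

/-! ### Second eigenvalue of a reversible stochastic matrix by deflation. -/

section SecondEigenvalue

open scoped Matrix
open Polynomial

variable {q : ℕ}

theorem le_headD_sort {R : Multiset ℝ} {r : ℝ} (hr : r ∈ R) : r ≤ (R.sort (· ≥ ·)).getD 0 0 := by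
  have hs := R.pairwise_sort (· ≥ ·)
  have hm : r ∈ R.sort (· ≥ ·) := (Multiset.mem_sort (· ≥ ·)).mpr hr
  cases h : R.sort (· ≥ ·) with
  | nil => simp [h] at hm
  | cons a l =>
    rw [h] at hm hs
    rcases List.mem_cons.mp hm with rfl | h'
    · simp
    · simpa using (List.pairwise_cons.mp hs).1 r h'

theorem headD_sort_mem (R : Multiset ℝ) :
    (R.sort (· ≥ ·)).getD 0 0 = 0 ∨ (R.sort (· ≥ ·)).getD 0 0 ∈ R := by
  cases h : R.sort (· ≥ ·) with
  | nil => simp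
  | cons a l =>
    right
    rw [← Multiset.mem_sort (· ≥ ·), h]
    simp

theorem secondLargest_cons {R : Multiset ℝ} {a : ℝ} (h : ∀ r ∈ R, r ≤ a) :
    secondLargest (a ::ₘ R) = (R.sort (· ≥ ·)).getD 0 0 := by
  rw [secondLargest, Multiset.sort_cons (r := (· ≥ ·)) _ _ (fun b hb => h b hb)]
  simp

/-- Deflation of the eigenvalue `1` of a matrix with unit row sums. -/
theorem charpoly_deflate {K : Matrix (Fin q) (Fin q) ℝ} {w : Fin q → ℝ}
    (hK : K *ᵥ 1 = 1) (hw : ∑ k, w k = 1) :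
    K.charpoly * X = (K - Matrix.vecMulVec 1 w).charpoly * (X - C 1) := by
  have hq : q ≠ 0 := by
    rintro rfl
    simp at hw
  have hne : (X - C (1 : ℝ)) ^ (q - 1) ≠ 0 := pow_ne_zero _ (X_sub_C_ne_zero 1)
  refine mul_right_cancel₀ hne (Polynomial.funext fun t => ?_)
  simp only [eval_mul, eval_X, eval_pow, eval_sub, eval_C, Matrix.eval_charpoly]
  -- Since `K 1 = 1`, one has `(t - K)(t - 1 + 1 wᵀ) = (t - 1)(t - K + 1 wᵀ)`. Taking determinants
  -- gives the claim times `(t - 1) ^ (q - 1)`, the factor introduced above for cancellation.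
  have hmul : (Matrix.scalar (Fin q) t - K) * (Matrix.scalar (Fin q) (t - 1) +
      Matrix.vecMulVec 1 w) = (t - 1) • (Matrix.scalar (Fin q) t - (K - Matrix.vecMulVec 1 w)) := by
    rw [mul_add, Matrix.mul_vecMulVec, Matrix.sub_mulVec, hK]
    ext i j
    simp [Matrix.vecMulVec, Matrix.scalar_apply]
    ring
  have hdet : (Matrix.scalar (Fin q) (t - 1) + Matrix.vecMulVec 1 w).det = (t - 1) ^ (q - 1) * t := by
    have h1 := Matrix.eval_charpoly (Matrix.vecMulVec (-1 : Fin q → ℝ) w) (t - 1)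
    rw [Matrix.charpoly_vecMulVec, Matrix.neg_vecMulVec, sub_neg_eq_add] at h1
    rw [← h1]
    have h2 : (-1 : Fin q → ℝ) ⬝ᵥ w = -1 := by simp [dotProduct, hw]
    obtain ⟨n, rfl⟩ := Nat.exists_eq_succ_of_ne_zero hq
    simp [h2, pow_succ]
    ring
  have h := congrArg Matrix.det hmul
  rw [Matrix.det_mul, hdet, Matrix.det_smul, Fintype.card_fin] at h
  obtain ⟨n, rfl⟩ := Nat.exists_eq_succ_of_ne_zero hq
  simp only [Nat.succ_eq_add_one, Nat.add_sub_cancel, pow_succ] at h ⊢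
  linarith

/-- Eigenvalues of a stochastic matrix have modulus at most one. -/
theorem abs_le_one_of_mem_roots_charpoly {K : Matrix (Fin q) (Fin q) ℝ} (hK : K *ᵥ 1 = 1)
    (hnn : ∀ k l, 0 ≤ K k l) {t : ℝ} (ht : t ∈ K.charpoly.roots) : |t| ≤ 1 := by
  have h := Matrix.mem_spectrum_iff_isRoot_charpoly.mpr (isRoot_of_mem_roots ht)
  rw [← Matrix.spectrum_toLin', ← Module.End.hasEigenvalue_iff_mem_spectrum] at h
  obtain ⟨v, hv⟩ := h.exists_hasEigenvector
  have hv1 : K *ᵥ v = t • v := by simpa using hv.apply_eq_smul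
  obtain ⟨i, hi⟩ := Function.ne_iff.mp hv.2
  obtain ⟨k, -, hk⟩ := Finset.exists_max_image Finset.univ (fun k => |v k|) ⟨i, Finset.mem_univ i⟩
  have hpos : 0 < |v k| := (abs_pos.mpr hi).trans_le (hk i (Finset.mem_univ i))
  have h1 : |t| * |v k| ≤ 1 * |v k| := by
    have e1 := congrFun hv1 k
    have e2 := congrFun hK k
    simp only [Matrix.mulVec, dotProduct, Pi.smul_apply, smul_eq_mul, Pi.one_apply, mul_one]
      at e1 e2
    rw [← abs_mul, ← e1, ← e2, Finset.sum_mul]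
    refine (Finset.abs_sum_le_sum_abs _ _).trans (Finset.sum_le_sum fun l _ => ?_)
    rw [abs_mul, abs_of_nonneg (hnn k l)]
    exact mul_le_mul_of_nonneg_left (hk l (Finset.mem_univ l)) (hnn k l)
  exact le_of_mul_le_mul_right h1 hpos

/-- A matrix satisfying detailed balance with respect to positive weights has a split
characteristic polynomial. -/
theorem splits_charpoly_of_detailed_balance {K : Matrix (Fin q) (Fin q) ℝ} {w : Fin q → ℝ}
    (hw : ∀ k, 0 < w k) (hb : ∀ k l, w k * K k l = w l * K l k) : K.charpoly.Splits := by
  have hd : ∀ k, √(w k) ≠ 0 := fun k => (Real.sqrt_pos.mpr (hw k)).ne'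
  rw [← charpoly_diagonal_conj hd K]
  refine Matrix.IsHermitian.splits_charpoly (Matrix.IsHermitian.ext fun k l => ?_)
  simp only [Matrix.mul_diagonal, Matrix.diagonal_mul, star_trivial]
  have h1 := hd k
  have h2 := hd l
  field_simp
  rw [Real.sq_sqrt (hw l).le, Real.sq_sqrt (hw k).le]
  exact hb l k

/-- The second largest modulus of an eigenvalue of a reversible stochastic matrix is the spectral
radius of the matrix deflated by its stationary distribution. -/
theorem secondEigenvalueAbs_eq_matrixRadius {K : Matrix (Fin q) (Fin q) ℝ} {w : Fin q → ℝ}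
    (hK : K *ᵥ 1 = 1) (hnn : ∀ k l, 0 ≤ K k l) (hw : ∀ k, 0 < w k) (hw1 : ∑ k, w k = 1)
    (hb : ∀ k l, w k * K k l = w l * K l k) :
    secondEigenvalueAbs K = matrixRadius (K - Matrix.vecMulVec 1 w) := by
  have hdef := charpoly_deflate hK hw1
  set K' := K - Matrix.vecMulVec 1 w with hK'
  have hsplit : K'.charpoly.Splits := by
    refine splits_charpoly_of_detailed_balance hw fun k l => ?_
    simp only [hK', Matrix.sub_apply, Matrix.vecMulVec_apply, Pi.one_apply, mul_sub, hb k l]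
    ring
  -- Deflation trades one eigenvalue `1` for an eigenvalue `0` and keeps all the others, which form
  -- `R` below.
  have hroots : (0 : ℝ) ::ₘ K.charpoly.roots = 1 ::ₘ K'.charpoly.roots := by
    have h := congrArg Polynomial.roots hdef
    rw [roots_mul (mul_ne_zero K.charpoly_monic.ne_zero X_ne_zero),
      roots_mul (mul_ne_zero K'.charpoly_monic.ne_zero (X_sub_C_ne_zero 1)), roots_X,
      roots_X_sub_C, add_comm, add_comm K'.charpoly.roots] at h
    simpa using h
  have h1 : (1 : ℝ) ∈ K.charpoly.roots := by
    have : (1 : ℝ) ∈ (0 : ℝ) ::ₘ K.charpoly.roots := by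
      rw [hroots]
      exact Multiset.mem_cons_self _ _
    simpa using this
  obtain ⟨R, hR⟩ := Multiset.exists_cons_of_mem h1
  have hR' : K'.charpoly.roots = 0 ::ₘ R := by
    rw [hR, Multiset.cons_swap] at hroots
    exact ((Multiset.cons_inj_right 1).mp hroots).symm
  have hle : ∀ r ∈ R.map fun t => |t|, r ≤ 1 := by
    intro r hr
    obtain ⟨t, ht, rfl⟩ := Multiset.mem_map.mp hr
    exact abs_le_one_of_mem_roots_charpoly hK hnn (hR ▸ Multiset.mem_cons_of_mem ht)
  -- For `q = 1` the multiset `R` is empty, and the default value `0` agrees with the radius of `K'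
  -- = 0`.
  rw [secondEigenvalueAbs, hR, Multiset.map_cons, abs_one, secondLargest_cons hle]
  refine le_antisymm ?_ (matrixRadius_le_of_splits hsplit ?_ fun t ht => ?_)
  · rcases headD_sort_mem (R.map fun t => |t|) with h | h
    · rw [h]
      exact matrixRadius_nonneg _
    · obtain ⟨t, ht, h⟩ := Multiset.mem_map.mp h
      rw [← h]
      exact abs_root_le_matrixRadius (hR' ▸ Multiset.mem_cons_of_mem ht)
  · rcases headD_sort_mem (R.map fun t => |t|) with h | h
    · exact h.ge
    · obtain ⟨t, ht, h⟩ := Multiset.mem_map.mp h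
      rw [← h]
      exact abs_nonneg t
  · rw [hR'] at ht
    rcases Multiset.mem_cons.mp ht with rfl | ht
    · rcases headD_sort_mem (R.map fun t => |t|) with h | h
      · simpa using h.ge
      · obtain ⟨t, ht, h⟩ := Multiset.mem_map.mp h
        rw [← h]
        simp
    · exact le_headD_sort (Multiset.mem_map_of_mem _ ht)

theorem secondEigenvalue_eq_secondEigenvalueAbs {K : Matrix (Fin q) (Fin q) ℝ}
    (h : ∀ t ∈ K.charpoly.roots, 0 ≤ t) : secondEigenvalue K = secondEigenvalueAbs K := by
  rw [secondEigenvalue, secondEigenvalueAbs,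
    Multiset.map_congr rfl fun t ht => abs_of_nonneg (h t ht), Multiset.map_id']

theorem nonneg_of_mem_roots_charpoly_transpose_mul_self (U : Matrix (Fin q) (Fin q) ℝ) {t : ℝ}
    (ht : t ∈ (Uᵀ * U).charpoly.roots) : 0 ≤ t := by
  have hp : (Uᵀ * U).PosSemidef := by
    rw [← Matrix.conjTranspose_eq_transpose_of_trivial]
    exact Matrix.posSemidef_conjTranspose_mul_self U
  rw [hp.1.roots_charpoly_eq_eigenvalues] at ht
  obtain ⟨i, -, rfl⟩ := Multiset.mem_map.mp ht
  exact hp.eigenvalues_nonneg i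

end SecondEigenvalue

/-! ### Block matrices dominated by a nonnegative matrix. -/

section Blocks

open scoped Matrix Matrix.Norms.L2Operator

variable {ι κ : Type*} [Fintype ι] [DecidableEq ι] [Fintype κ] [DecidableEq κ]

/-- The C⋆-identity, together with norm equal to spectral radius for self-adjoint elements; the
latter is a complex statement, hence the passage to `ℂ`. -/
theorem l2_opNorm_map_sq (R : Matrix κ κ ℝ) :
    ‖R.map (algebraMap ℝ ℂ)‖ * ‖R.map (algebraMap ℝ ℂ)‖ = matrixRadius (Rᵀ * R) := by
  have h : (Rᵀ * R).map (algebraMap ℝ ℂ) =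
      (R.map (algebraMap ℝ ℂ))ᴴ * R.map (algebraMap ℝ ℂ) := by
    rw [Matrix.map_mul]
    congr 1
    ext i j
    simp
  rw [← Matrix.l2_opNorm_conjTranspose_mul_self, matrixRadius, h]
  exact ((IsSelfAdjoint.star_mul_self
    (R.map (algebraMap ℝ ℂ))).toReal_spectralRadius_complex_eq_norm).symm

theorem norm_entry_le_l2_opNorm (X : Matrix κ κ ℂ) (k l : κ) : ‖X k l‖ ≤ ‖X‖ := by
  have h := Matrix.l2_opNorm_mulVec X (EuclideanSpace.single l 1)
  rw [PiLp.norm_single, norm_one, mul_one] at h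
  refine le_trans ?_ h
  have h2 := PiLp.norm_apply_le
    (WithLp.toLp 2 (X *ᵥ (EuclideanSpace.single l (1 : ℂ)).ofLp) : EuclideanSpace ℂ κ) k
  refine le_trans (le_of_eq ?_) h2
  simp

/-- If the blocks of `X` are dominated in norm by the entries of `c • A`, then the entries of the
powers of `X` are dominated by those of the powers of `c • A`. -/
theorem norm_block_pow_le {X : Matrix (ι × κ) (ι × κ) ℝ} {A : Matrix ι ι ℝ} {c : ℝ}
    (h : ∀ e f, ‖Matrix.of fun k l => (X (e, k) (f, l) : ℂ)‖ ≤ c * A e f) (n : ℕ) (e f : ι) :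
    ‖Matrix.of fun k l => ((X ^ n) (e, k) (f, l) : ℂ)‖ ≤ ((c • A) ^ n) e f := by
  induction n generalizing f with
  | zero =>
    simp only [pow_zero]
    by_cases hef : e = f
    · subst hef
      have : (Matrix.of fun k l => ((1 : Matrix (ι × κ) (ι × κ) ℝ) (e, k) (e, l) : ℂ)) =
          Matrix.diagonal fun _ => 1 := by
        ext k l
        by_cases hkl : k = l <;> simp [Matrix.one_apply, hkl]
      rw [this, Matrix.l2_opNorm_diagonal, Matrix.one_apply_eq]
      exact (pi_norm_le_iff_of_nonneg zero_le_one).mpr fun _ => by simp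
    · have : (Matrix.of fun k l => ((1 : Matrix (ι × κ) (ι × κ) ℝ) (e, k) (f, l) : ℂ)) = 0 := by
        ext k l
        simp [hef]
      rw [this, norm_zero, Matrix.one_apply_ne hef]
  | succ n ih =>
    have hX : (Matrix.of fun k l => ((X ^ (n + 1)) (e, k) (f, l) : ℂ)) =
        ∑ g, (Matrix.of fun k l => ((X ^ n) (e, k) (g, l) : ℂ)) *
          Matrix.of fun k l => (X (g, k) (f, l) : ℂ) := by
      ext k l
      rw [Matrix.sum_apply, Matrix.of_apply, pow_succ, Matrix.mul_apply, Fintype.sum_prod_type]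
      push_cast
      simp [Matrix.mul_apply]
    rw [hX, pow_succ, Matrix.mul_apply]
    refine (norm_sum_le _ _).trans (Finset.sum_le_sum fun g _ => ?_)
    refine (norm_mul_le _ _).trans ?_
    exact mul_le_mul (ih g) (h g f) (norm_nonneg _) ((norm_nonneg _).trans (ih g))

end Blocks

theorem matrixRadius_lt_one_of_abs_pow_le {ι κ : Type*} [Fintype ι] [DecidableEq ι]
    [Fintype κ] [DecidableEq κ] {X : Matrix (ι × κ) (ι × κ) ℝ} {A : Matrix ι ι ℝ}
    (hA : matrixRadius A < 1) (h : ∀ n e k f l, |(X ^ n) (e, k) (f, l)| ≤ (A ^ n) e f) :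
    matrixRadius X < 1 := by
  refine matrixRadius_lt_one_of_tendsto fun p r => squeeze_zero_norm
    (fun n => h n p.1 p.2 r.1 r.2) ?_
  refine squeeze_zero_norm (fun n => ?_) (tendsto_pow_of_matrixRadius_lt_one hA)
  exact abs_entry_le_norm _ _ _

open scoped Matrix.Norms.L2Operator in
theorem matrixRadius_lt_one_of_norm_block_le {ι κ : Type*} [Fintype ι] [DecidableEq ι]
    [Fintype κ] [DecidableEq κ] {X : Matrix (ι × κ) (ι × κ) ℝ} {A : Matrix ι ι ℝ} {c : ℝ}
    (hc : 0 ≤ c) (hA : matrixRadius A * c < 1)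
    (h : ∀ e f, ‖Matrix.of fun k l => (X (e, k) (f, l) : ℂ)‖ ≤ c * A e f) :
    matrixRadius X < 1 := by
  refine matrixRadius_lt_one_of_abs_pow_le (A := c • A) ?_ fun n e k f l => ?_
  · rwa [matrixRadius_smul hc, mul_comm]
  · refine le_trans ?_ (norm_block_pow_le h n e f)
    simpa using norm_entry_le_l2_opNorm
      (Matrix.of fun k l => ((X ^ n) (e, k) (f, l) : ℂ)) k l

/-! ### Stability and instability of fixed points from the Jacobian. -/

section Dynamics

open scoped Matrix Matrix.Norms.Operator

variable {ι : Type*} [Fintype ι] [DecidableEq ι]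

/-- A fixed point at which an iterate contracts distances is locally asymptotically stable. -/
theorem locallyAsymptoticallyStable_of_iterate_contracts {E : Type*} [NormedAddCommGroup E]
    {f : E → E} {x : E} (hx : f x = x) (hc : ContinuousAt f x) {N : ℕ} (hN : 0 < N) {c : ℝ}
    (hc1 : c < 1) (h : ∀ᶠ y in 𝓝 x, ‖f^[N] y - x‖ ≤ c * ‖y - x‖) :
    LocallyAsymptoticallyStable f x := by
  wlog hc0 : 0 ≤ c generalizing c
  · refine this one_half_lt_one (h.mono fun y hy => hy.trans ?_) (by norm_num)
    gcongr
    linarith [not_le.mp hc0]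
  have hcont : ∀ k, Tendsto f^[k] (𝓝 x) (𝓝 x) := fun k => by
    have := hc.iterate hx k
    rwa [ContinuousAt, Function.iterate_fixed hx] at this
  obtain ⟨δ, hδ, hball⟩ := Metric.eventually_nhds_iff_ball.mp h
  have hG : ∀ ε ≤ δ, ∀ y ∈ Metric.ball x ε, ∀ n,
      (f^[N])^[n] y ∈ Metric.ball x ε ∧ ‖(f^[N])^[n] y - x‖ ≤ c ^ n * ‖y - x‖ := by
    intro ε hε y hy n
    induction n with
    | zero => simpa using hy
    | succ n ih =>
      have h1 := hball _ (Metric.ball_subset_ball hε ih.1)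
      rw [Function.iterate_succ_apply' (f^[N])]
      constructor
      · rw [mem_ball_iff_norm] at ih ⊢
        exact (h1.trans (mul_le_of_le_one_left (norm_nonneg _) hc1.le)).trans_lt ih.1
      · rw [pow_succ', mul_assoc]
        exact h1.trans (mul_le_mul_of_nonneg_left ih.2 hc0)
  -- The contracting iterate controls multiples of `N`; the fewer than `N` remaining steps are
  -- handled by continuity at `x`.
  have hsplit : ∀ n y, f^[n] y = f^[n % N] ((f^[N])^[n / N] y) := fun n y => by
    rw [← Function.iterate_mul, ← Function.iterate_add_apply, Nat.mod_add_div]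
  refine ⟨fun U hU => ?_, ?_⟩
  · have hV : ∀ᶠ y in 𝓝 x, ∀ k ∈ Finset.range N, f^[k] y ∈ U :=
      (Filter.eventually_all_finset _).mpr fun k _ => hcont k hU
    obtain ⟨ε, hε, hεV⟩ := Metric.eventually_nhds_iff_ball.mp hV
    filter_upwards [Metric.ball_mem_nhds x (lt_min hε hδ)] with y hy n
    rw [hsplit n y]
    refine hεV _ (Metric.ball_subset_ball (min_le_left ε δ) ?_) _
      (Finset.mem_range.mpr (Nat.mod_lt n hN))
    exact (hG _ (min_le_right _ _) y hy _).1
  · filter_upwards [Metric.ball_mem_nhds x hδ] with y hy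
    have hlim : Tendsto (fun n => (f^[N])^[n] y) atTop (𝓝 x) := by
      rw [tendsto_iff_norm_sub_tendsto_zero]
      refine squeeze_zero (fun _ => norm_nonneg _) (fun n => (hG δ le_rfl y hy n).2) ?_
      simpa using (tendsto_pow_atTop_nhds_zero_of_lt_one hc0 hc1).mul_const ‖y - x‖
    intro U hU
    have hV : ∀ᶠ y in 𝓝 x, ∀ k ∈ Finset.range N, f^[k] y ∈ U :=
      (Filter.eventually_all_finset _).mpr fun k _ => hcont k hU
    have h1 := (hlim.comp (Nat.tendsto_div_const_atTop hN.ne')).eventually hV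
    refine Filter.mem_map.mpr (Filter.mem_of_superset h1 fun n hn => ?_)
    rw [Set.mem_preimage, hsplit n y]
    exact hn _ (Finset.mem_range.mpr (Nat.mod_lt n hN))

theorem toMatrix_pow_mulVec (L : (ι → ℝ) →L[ℝ] ι → ℝ) (n : ℕ) (v : ι → ℝ) :
    (LinearMap.toMatrix' L.toLinearMap ^ n) *ᵥ v = (L ^ n) v := by
  induction n generalizing v with
  | zero => simp
  | succ n ih =>
    rw [pow_succ, ← Matrix.mulVec_mulVec, ih, pow_succ, mul_apply_eq_comp]
    congr 1
    exact LinearMap.toMatrix'_mulVec _ _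

/-- Some power of the Jacobian has norm below `1/2`. It is the derivative of the corresponding
iterate, whose remainder contributes at most `1/4` near `x`. -/
theorem LinearlyStable.locallyAsymptoticallyStable {f : (ι → ℝ) → ι → ℝ} {x : ι → ℝ}
    (h : LinearlyStable f x) (hx : f x = x) : LocallyAsymptoticallyStable f x := by
  obtain ⟨hd, hr⟩ := h
  have h1 := (tendsto_pow_of_matrixRadius_lt_one hr).eventually_lt_const one_half_pos
  obtain ⟨N, hN, h0⟩ := (h1.and (eventually_gt_atTop 0)).exists
  refine locallyAsymptoticallyStable_of_iterate_contracts hx hd.continuousAt h0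
    (c := 1 / 2 + 1 / 4) (by norm_num) ?_
  have h2 := (hd.hasFDerivAt.iterate hx N).isLittleO.def (c := 1 / 4) (by norm_num)
  filter_upwards [h2] with y hy
  rw [Function.iterate_fixed hx] at hy
  have h3 : ‖(fderiv ℝ f x ^ N) (y - x)‖ ≤ 1 / 2 * ‖y - x‖ := by
    rw [← toMatrix_pow_mulVec]
    refine (Matrix.linfty_opNorm_mulVec _ _).trans ?_
    gcongr
  calc ‖f^[N] y - x‖
      = ‖(f^[N] y - x - (fderiv ℝ f x ^ N) (y - x)) + (fderiv ℝ f x ^ N) (y - x)‖ := by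
        rw [sub_add_cancel]
    _ ≤ _ := norm_add_le _ _
    _ ≤ (1 / 2 + 1 / 4) * ‖y - x‖ := by linarith

/-- Second order Taylor estimate. -/
theorem exists_quadratic_remainder {E : Type*} [NormedAddCommGroup E] [NormedSpace ℝ E]
    {f : E → E} {x : E} (hf : ContDiffAt ℝ 2 f x) :
    ∃ c ε : ℝ, 0 < c ∧ 0 < ε ∧ ∀ y ∈ Metric.ball x ε,
      ‖f y - f x - fderiv ℝ f x (y - x)‖ ≤ c * ‖y - x‖ ^ 2 := by
  have h1 : ContDiffAt ℝ 1 (fderiv ℝ f) x := hf.fderiv_right (m := 1) (by norm_num)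
  obtain ⟨K, t, ht, hK⟩ := h1.exists_lipschitzOnWith
  have hd : ∀ᶠ y in 𝓝 x, DifferentiableAt ℝ f y :=
    (hf.eventually (by simp)).mono fun y hy => hy.differentiableAt (by simp)
  obtain ⟨ε, hε, hb⟩ := Metric.eventually_nhds_iff_ball.mp (hd.and ht)
  refine ⟨K + 1, ε, by positivity, hε, fun y hy => ?_⟩
  have hxt : x ∈ t := (hb x (Metric.mem_ball_self hε)).2
  have hyε : ‖y - x‖ < ε := mem_ball_iff_norm.mp hy
  have hsub : ∀ w ∈ Metric.closedBall x ‖y - x‖, w ∈ Metric.ball x ε := fun w hw =>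
    Metric.closedBall_subset_ball hyε hw
  -- Mean value inequality on the ball of radius `‖y - x‖`, where the Lipschitz derivative differs
  -- from its value at `x` by at most `K * ‖y - x‖`.
  have key := (convex_closedBall x ‖y - x‖).norm_image_sub_le_of_norm_fderiv_le'
    (f := f) (φ := fderiv ℝ f x) (C := K * ‖y - x‖)
    (fun w hw => (hb w (hsub w hw)).1) (fun w hw => ?_)
    (Metric.mem_closedBall_self (norm_nonneg _)) (y := y) (mem_closedBall_iff_norm.mpr le_rfl)
  · refine key.trans ?_
    nlinarith [sq_nonneg ‖y - x‖]
  · have h2 := hK.dist_le_mul w (hb w (hsub w hw)).2 x hxt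
    rw [dist_eq_norm, dist_eq_norm] at h2
    refine h2.trans ?_
    gcongr
    exact mem_closedBall_iff_norm.mp hw

theorem mulVec_re (X : Matrix ι ι ℝ) (u : ι → ℂ) :
    X *ᵥ (fun j => (u j).re) = fun j => ((X.map (algebraMap ℝ ℂ)) *ᵥ u) j |>.re := by
  ext j
  simp [Matrix.mulVec, dotProduct]

theorem pow_mulVec_re {X : Matrix ι ι ℝ} {z : ℂ} {v : ι → ℂ}
    (hv : (X.map (algebraMap ℝ ℂ)) *ᵥ v = z • v) (a : ℂ) (n : ℕ) :
    (X ^ n) *ᵥ (fun j => (a * v j).re) = fun j => (z ^ n * (a * v j)).re := by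
  induction n with
  | zero => simp
  | succ n ih =>
    rw [pow_succ', ← Matrix.mulVec_mulVec, ih, mulVec_re]
    ext j
    have : (fun j => z ^ n * (a * v j)) = (z ^ n * a) • v := by
      ext j
      simp [mul_assoc]
    rw [this, Matrix.mulVec_smul, hv]
    simp only [Pi.smul_apply, smul_eq_mul]
    ring_nf

/-- Variation of constants formula for a discrete time system. -/
theorem variation_of_constants (X : Matrix ι ι ℝ) (u : ℕ → ι → ℝ) (n : ℕ) :
    u n - (X ^ n) *ᵥ u 0 =
      ∑ k ∈ Finset.range n, (X ^ (n - 1 - k)) *ᵥ (u (k + 1) - X *ᵥ u k) := by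
  induction n with
  | zero => simp
  | succ n ih =>
    rw [Finset.sum_range_succ]
    have h : ∑ k ∈ Finset.range n, (X ^ (n + 1 - 1 - k)) *ᵥ (u (k + 1) - X *ᵥ u k) =
        X *ᵥ (u n - (X ^ n) *ᵥ u 0) := by
      rw [ih, Matrix.mulVec_sum]
      refine Finset.sum_congr rfl fun k hk => ?_
      have hk' := Finset.mem_range.mp hk
      rw [Matrix.mulVec_mulVec, ← pow_succ']
      congr 2
      omega
    rw [h, Matrix.mulVec_sub, Matrix.mulVec_mulVec, ← pow_succ']
    simp

/-- As long as the linear growth `d * r ^ n` is at most `a`, a quadratic perturbation of a linear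
system with powers bounded by `C * s ^ n`, where `s < r ^ 2`, stays close to the linear system. -/
theorem norm_sub_pow_mulVec_le {X : Matrix ι ι ℝ} {u : ℕ → ι → ℝ} {C r s c V a d : ℝ} {N : ℕ}
    (hC : 0 ≤ C) (hs : 0 ≤ s) (hr : 1 ≤ r) (hsr : s < r ^ 2) (hc : 0 ≤ c) (hV : 1 ≤ V)
    (hd : 0 ≤ d)
    (hX : ∀ n, ‖X ^ n‖ ≤ C * s ^ n) (hu : ∀ k, ‖u (k + 1) - X *ᵥ u k‖ ≤ c * ‖u k‖ ^ 2)
    (hlin : ∀ n, ‖(X ^ n) *ᵥ u 0‖ ≤ d * r ^ n * V) (hN : d * r ^ N ≤ a)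
    (ha : C * c * (2 * V) ^ 2 * a ≤ (r ^ 2 - s) / 2) (n : ℕ) (hn : n ≤ N) :
    ‖u n - (X ^ n) *ᵥ u 0‖ ≤ d * r ^ n / 2 := by
  induction n using Nat.strong_induction_on with
  | _ n ih =>
  have hr0 : 0 ≤ r := zero_le_one.trans hr
  -- By induction the earlier errors are at most `d * r ^ k / 2`, so `u k` has the size of the
  -- linear orbit.
  have hnorm : ∀ k < n, ‖u k‖ ≤ 2 * V * (d * r ^ k) := fun k hk => by
    have h1 := ih k hk (hk.le.trans hn)
    have h2 := norm_le_norm_add_norm_sub' (u k) ((X ^ k) *ᵥ u 0)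
    have h3 : 0 ≤ d * r ^ k := by positivity
    nlinarith [hlin k]
  -- As `s < r ^ 2`, the accumulated error is of order `(d * r ^ n) ^ 2`, hence at most `a` times `d
  -- * r ^ n` up to a constant.
  have hgeom : (∑ k ∈ Finset.range n, (r ^ 2) ^ k * s ^ (n - 1 - k)) * (r ^ 2 - s) ≤
      (r ^ n) ^ 2 := by
    rw [(Commute.all (r ^ 2) s).geom_sum₂_mul, ← pow_mul, ← pow_mul, mul_comm 2 n]
    exact sub_le_self _ (by positivity)
  have hsum : ‖u n - (X ^ n) *ᵥ u 0‖ ≤ C * c * (2 * V) ^ 2 * d ^ 2 *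
      ∑ k ∈ Finset.range n, (r ^ 2) ^ k * s ^ (n - 1 - k) := by
    rw [variation_of_constants, Finset.mul_sum]
    refine (norm_sum_le _ _).trans (Finset.sum_le_sum fun k hk => ?_)
    have hk' := hnorm k (Finset.mem_range.mp hk)
    calc ‖(X ^ (n - 1 - k)) *ᵥ (u (k + 1) - X *ᵥ u k)‖
        ≤ ‖X ^ (n - 1 - k)‖ * ‖u (k + 1) - X *ᵥ u k‖ := Matrix.linfty_opNorm_mulVec _ _
      _ ≤ (C * s ^ (n - 1 - k)) * (c * (2 * V * (d * r ^ k)) ^ 2) := by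
          refine mul_le_mul (hX _) ((hu k).trans ?_) (norm_nonneg _) (by positivity)
          gcongr
      _ = _ := by ring
  have hpos : 0 < r ^ 2 - s := sub_pos.mpr hsr
  have hna : d * r ^ n ≤ a :=
    (mul_le_mul_of_nonneg_left (pow_le_pow_right₀ hr hn) hd).trans hN
  have h0 : 0 ≤ C * c * (2 * V) ^ 2 * d ^ 2 := by positivity
  refine le_of_mul_le_mul_right ?_ hpos
  calc ‖u n - (X ^ n) *ᵥ u 0‖ * (r ^ 2 - s)
      ≤ C * c * (2 * V) ^ 2 * d ^ 2 *
        ((∑ k ∈ Finset.range n, (r ^ 2) ^ k * s ^ (n - 1 - k)) * (r ^ 2 - s)) := by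
        rw [← mul_assoc]
        exact mul_le_mul_of_nonneg_right hsum hpos.le
    _ ≤ C * c * (2 * V) ^ 2 * d ^ 2 * (r ^ n) ^ 2 := mul_le_mul_of_nonneg_left hgeom h0
    _ = C * c * (2 * V) ^ 2 * (d * r ^ n) * (d * r ^ n) := by ring
    _ ≤ C * c * (2 * V) ^ 2 * a * (d * r ^ n) := by gcongr
    _ ≤ (r ^ 2 - s) / 2 * (d * r ^ n) := by gcongr
    _ = d * r ^ n / 2 * (r ^ 2 - s) := by ring

/-- Instability of a fixed point at which the spectral radius of the Jacobian matrix exceeds `1`. -/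
theorem not_lyapunovStable_of_one_lt_matrixRadius {f : (ι → ℝ) → ι → ℝ} {x : ι → ℝ}
    (hx : f x = x) (hf : ContDiffAt ℝ 2 f x)
    (h : 1 < matrixRadius (LinearMap.toMatrix' (fderiv ℝ f x).toLinearMap)) :
    ¬ LyapunovStable f x := by
  intro hstab
  set X := LinearMap.toMatrix' (fderiv ℝ f x).toLinearMap with hXdef
  set r := matrixRadius X with hrdef
  have hne : Nonempty ι := by
    by_contra hempty
    rw [not_nonempty_iff] at hempty
    have : X = 0 := Subsingleton.elim _ _
    rw [hrdef, this, matrixRadius_zero] at h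
    exact absurd h (by norm_num)
  have hr0 : 0 < r := one_pos.trans h
  -- Powers grow at most like `s ^ n` for any `s > r`; keeping `s` below `r ^ 2` makes quadratic
  -- errors harmless without any spectral gap.
  obtain ⟨s, hs1, hs2⟩ := exists_between (show r < r ^ 2 by nlinarith)
  obtain ⟨C, hC, hCs⟩ := exists_norm_pow_le hs1
  obtain ⟨z, v₀, hz, hv₀, hev₀⟩ := exists_eigenvector_norm_eq_matrixRadius X
  rw [← hrdef] at hz
  obtain ⟨i, hi⟩ := Function.ne_iff.mp hv₀
  rw [Pi.zero_apply] at hi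
  obtain ⟨v, hvi, hev⟩ : ∃ v : ι → ℂ, v i = 1 ∧ (X.map (algebraMap ℝ ℂ)) *ᵥ v = z • v :=
    ⟨(v₀ i)⁻¹ • v₀, by simp [hi], by rw [Matrix.mulVec_smul, hev₀, smul_comm]⟩
  have hV : 1 ≤ ‖v‖ := by simpa [hvi] using norm_le_pi_norm v i
  obtain ⟨c, ε, hc, hε, hquad⟩ := exists_quadratic_remainder hf
  rw [hx] at hquad
  obtain ⟨a, ha, haC⟩ : ∃ a : ℝ, 0 < a ∧ C * c * (2 * ‖v‖) ^ 2 * a ≤ (r ^ 2 - s) / 2 := by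
    have h1 : 0 < (r ^ 2 - s) / 2 := by linarith
    have h2 : 0 ≤ C * c * (2 * ‖v‖) ^ 2 := by positivity
    refine ⟨(r ^ 2 - s) / 2 / (C * c * (2 * ‖v‖) ^ 2 + 1), by positivity, ?_⟩
    rw [mul_div_assoc', div_le_iff₀ (by positivity)]
    nlinarith
  have hη : 0 < min ε (a / 2) := lt_min hε (by positivity)
  obtain ⟨δ, hδ, horb⟩ := Metric.eventually_nhds_iff_ball.mp
    (hstab _ (Metric.ball_mem_nhds x hη))
  -- The start has size `a / r ^ N`, so the linear orbit reaches the fixed size `a` at time `N`,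
  -- however small `δ` is.
  obtain ⟨N, hN⟩ : ∃ N : ℕ, a / r ^ N * ‖v‖ < δ := by
    have h1 : Tendsto (fun n : ℕ => a / r ^ n * ‖v‖) atTop (𝓝 0) := by
      have := ((tendsto_const_nhds (x := a)).div_atTop
        (tendsto_pow_atTop_atTop_of_one_lt h)).mul_const ‖v‖
      simpa using this
    exact (h1.eventually_lt_const hδ).exists
  set d := a / r ^ N with hd
  have hd0 : 0 < d := by positivity
  have hdN : d * r ^ N = a := by rw [hd]; field_simp
  -- The phase `ω ^ N` cancels the rotation of `z ^ N`: at time `N` coordinate `i` of the linear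
  -- orbit is exactly `a`, and taking real parts loses nothing.
  set ω : ℂ := (starRingEnd ℂ) z / r with hω
  have hωz : z * ω = r := by
    rw [hω, mul_div_assoc', Complex.mul_conj, Complex.normSq_eq_norm_sq, hz]
    have : (r : ℂ) ≠ 0 := by exact_mod_cast hr0.ne'
    push_cast
    field_simp
  have hωn : ‖ω‖ = 1 := by
    rw [hω, norm_div, RCLike.norm_conj, hz, Complex.norm_real, Real.norm_of_nonneg hr0.le,
      div_self hr0.ne']
  set w : ι → ℝ := fun j => ((d * ω ^ N) * v j).re with hw
  have hXw : ∀ n, (X ^ n) *ᵥ w = fun j => (z ^ n * ((d * ω ^ N) * v j)).re :=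
    pow_mulVec_re hev _
  have hlin : ∀ n, ‖(X ^ n) *ᵥ w‖ ≤ d * r ^ n * ‖v‖ := fun n => by
    rw [hXw]
    refine (pi_norm_le_iff_of_nonneg (by positivity)).mpr fun j => ?_
    refine (Complex.abs_re_le_norm _).trans ?_
    rw [norm_mul, norm_mul, norm_mul, norm_pow, norm_pow, hz, hωn, one_pow, mul_one,
      Complex.norm_real, Real.norm_of_nonneg hd0.le, ← mul_assoc, mul_comm (r ^ n)]
    gcongr
    exact norm_le_pi_norm v j
  have hwi : ((X ^ N) *ᵥ w) i = a := by
    rw [hXw]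
    beta_reduce
    rw [hvi, mul_one, mul_left_comm, ← mul_pow, hωz, ← hdN]
    norm_cast
  set u : ℕ → ι → ℝ := fun n => f^[n] (x + w) - x with hu
  have hu0 : u 0 = w := by simp [hu]
  have hball : ∀ n, ‖u n‖ < min ε (a / 2) := fun n => by
    refine mem_ball_iff_norm.mp (horb (x + w) ?_ n)
    rw [mem_ball_iff_norm, add_sub_cancel_left]
    have := hlin 0
    simp only [pow_zero, Matrix.one_mulVec, mul_one] at this
    exact this.trans_lt hN
  have hrem : ∀ k, ‖u (k + 1) - X *ᵥ u k‖ ≤ c * ‖u k‖ ^ 2 := fun k => by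
    have h1 := hquad (f^[k] (x + w)) (mem_ball_iff_norm.mpr ((hball k).trans_le (min_le_left _ _)))
    have h2 : X *ᵥ u k = fderiv ℝ f x (u k) := LinearMap.toMatrix'_mulVec _ _
    rw [h2]
    simpa only [hu, Function.iterate_succ_apply'] using h1
  have hfin := norm_sub_pow_mulVec_le hC (hr0.le.trans hs1.le) h.le hs2 hc.le hV hd0.le hCs hrem
    (by rwa [hu0]) hdN.le haC N le_rfl
  have h1 := norm_le_pi_norm (u N - (X ^ N) *ᵥ u 0) i
  rw [Pi.sub_apply, hu0, hwi, Real.norm_eq_abs] at h1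
  have h2 := (norm_le_pi_norm (u N) i).trans_lt ((hball N).trans_le (min_le_right _ _))
  rw [Real.norm_eq_abs] at h2
  -- Coordinate `i` at time `N` is at least `a - a / 2`, yet stability keeps it strictly below `a /
  -- 2`.
  have h3 := (abs_le.mp (h1.trans (hu0 ▸ hfin))).1
  have h4 := (abs_lt.mp h2).2
  linarith

end Dynamics

/-! ### Beliefs at a fixed point: marginals and detailed balance. -/

section

variable {V F : Type*} [Fintype V] [DecidableEq V] [Fintype F] [DecidableEq F] {q : ℕ}

namespace MarkovField

open scoped Matrix

/-- The product `ψ_a(x_a) ∏_{j ∈ a \ i} n_{j → a}(x_j)` of the plain update. -/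
def cavityWeight (M : MarkovField V F q) (m : M.Messages) (a : F) (i : M.scope a)
    (x : M.scope a → Fin q) : ℝ :=
  M.psi a x * ∏ j : M.scope a with j ≠ i, M.varMessage m j a (x j)

variable {M : MarkovField V F q} {m : M.Messages}

/-- The edge `ai` given by a variable `i` in the scope of the factor `a`. -/
abbrev edge (a : F) (i : M.scope a) : M.Edge := ⟨(a, i), i.2⟩

theorem plainUpdate_eq (a : F) (i : M.scope a) (k : Fin q) :
    M.plainUpdate m (edge a i, k) = ∑ x : M.scope a → Fin q with x i = k,
      M.cavityWeight m a i x := rfl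

theorem varMessage_pos (hpos : ∀ p, 0 < m p) (j : V) (a : F) (k : Fin q) :
    0 < M.varMessage m j a k :=
  mul_pos (M.phi_pos j k) (Finset.prod_pos fun _ _ => hpos _)

theorem cavityWeight_pos (hpos : ∀ p, 0 < m p) (a : F) (i : M.scope a) (x : M.scope a → Fin q) :
    0 < M.cavityWeight m a i x :=
  mul_pos (M.psi_pos a x) (Finset.prod_pos fun _ _ => varMessage_pos hpos _ _ _)

theorem plainUpdate_pos (hpos : ∀ p, 0 < m p) (p : M.Edge × Fin q) : 0 < M.plainUpdate m p :=
  Finset.sum_pos (fun x _ => cavityWeight_pos hpos p.1.1.1 ⟨p.1.1.2, p.1.2⟩ x)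
    ⟨fun _ => p.2, by simp⟩

theorem Zmess_pos [Nonempty (Fin q)] (hpos : ∀ p, 0 < m p) (e : M.Edge) : 0 < M.Zmess m e :=
  Finset.sum_pos (fun _ _ => plainUpdate_pos hpos _) Finset.univ_nonempty

theorem plainUpdate_eq_of_fixed (hpos : ∀ p, 0 < m p) (hfix : M.normUpdate m = m)
    (p : M.Edge × Fin q) : M.plainUpdate m p = M.Zmess m p.1 * m p := by
  have : Nonempty (Fin q) := ⟨p.2⟩
  have h := congrFun hfix p
  rw [normUpdate, div_eq_iff (Zmess_pos hpos p.1).ne'] at h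
  rw [h, mul_comm]

theorem sum_messages_eq_one [Nonempty (Fin q)] (hpos : ∀ p, 0 < m p)
    (hfix : M.normUpdate m = m) (e : M.Edge) : ∑ k, m (e, k) = 1 := by
  have h : M.Zmess m e = M.Zmess m e * ∑ k, m (e, k) := by
    conv_lhs => rw [Zmess]
    rw [Finset.mul_sum]
    exact Finset.sum_congr rfl fun k _ => plainUpdate_eq_of_fixed hpos hfix (e, k)
  exact (mul_left_cancel₀ (Zmess_pos hpos e).ne' (by rw [mul_one]; exact h)).symm

/-- The unnormalized belief `φ_i(k) ∏_{a ∋ i} m_{a → i}(k)`. -/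
def varWeight (M : MarkovField V F q) (m : M.Messages) (i : V) (k : Fin q) : ℝ :=
  M.phi i k * ∏ e : M.Edge with e.1.2 = i, m (e, k)

/-- The unnormalized belief `ψ_a(x_a) ∏_{i ∈ a} n_{i → a}(x_i)`. -/
def factorWeight (M : MarkovField V F q) (m : M.Messages) (a : F) (x : M.scope a → Fin q) : ℝ :=
  M.psi a x * ∏ i : M.scope a, M.varMessage m i a (x i)

theorem varBelief_eq (i : V) (k : Fin q) :
    M.varBelief m i k = M.varWeight m i k / ∑ l, M.varWeight m i l := rfl

theorem factorBelief_eq (a : F) (x : M.scope a → Fin q) :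
    M.factorBelief m a x = M.factorWeight m a x / ∑ y, M.factorWeight m a y := rfl

theorem varWeight_pos (hpos : ∀ p, 0 < m p) (i : V) (k : Fin q) : 0 < M.varWeight m i k :=
  mul_pos (M.phi_pos i k) (Finset.prod_pos fun _ _ => hpos _)

theorem factorWeight_pos (hpos : ∀ p, 0 < m p) (a : F) (x : M.scope a → Fin q) :
    0 < M.factorWeight m a x :=
  mul_pos (M.psi_pos a x) (Finset.prod_pos fun _ _ => varMessage_pos hpos _ _ _)

theorem varBelief_pos (hpos : ∀ p, 0 < m p) (i : V) (k : Fin q) : 0 < M.varBelief m i k :=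
  div_pos (varWeight_pos hpos i k)
    (Finset.sum_pos (fun _ _ => varWeight_pos hpos _ _) ⟨k, Finset.mem_univ k⟩)

theorem sum_varBelief [Nonempty (Fin q)] (hpos : ∀ p, 0 < m p) (i : V) :
    ∑ k, M.varBelief m i k = 1 := by
  simp only [varBelief_eq, ← Finset.sum_div]
  exact div_self (Finset.sum_pos (fun _ _ => varWeight_pos hpos _ _) Finset.univ_nonempty).ne'

theorem factorBelief_pos (hpos : ∀ p, 0 < m p) (a : F) (x : M.scope a → Fin q) :
    0 < M.factorBelief m a x :=
  div_pos (factorWeight_pos hpos a x)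
    (Finset.sum_pos (fun _ _ => factorWeight_pos hpos _ _) ⟨x, Finset.mem_univ x⟩)

theorem varWeight_eq_mul (a : F) (i : M.scope a) (k : Fin q) :
    M.varWeight m i k = M.varMessage m i a k * m (edge a i, k) := by
  have h : (Finset.univ.filter fun e : M.Edge => e.1.2 = i) =
      insert (edge a i) (Finset.univ.filter fun e : M.Edge => e.1.2 = i ∧ e.1.1 ≠ a) := by
    ext ⟨⟨b, j⟩, hj⟩
    simp only [Finset.mem_filter, Finset.mem_univ, true_and, Finset.mem_insert, Subtype.mk.injEq,
      Prod.mk.injEq]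
    tauto
  rw [varWeight, varMessage, h, Finset.prod_insert (by simp)]
  ring

theorem factorWeight_eq_mul (a : F) (i : M.scope a) (x : M.scope a → Fin q) :
    M.factorWeight m a x = M.varMessage m i a (x i) * M.cavityWeight m a i x := by
  rw [factorWeight, cavityWeight, ← Finset.mul_prod_erase _ _ (Finset.mem_univ i),
    Finset.filter_ne']
  ring

/-- The fixed point equation `Θ = Z^mess m` enters here: multiplying it by `n_{i → a}(k)` gives
marginal consistency of the beliefs. -/
theorem sum_factorWeight_eq (hpos : ∀ p, 0 < m p) (hfix : M.normUpdate m = m) (a : F)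
    (i : M.scope a) (k : Fin q) :
    ∑ x : M.scope a → Fin q with x i = k, M.factorWeight m a x =
      M.Zmess m (edge a i) * M.varWeight m i k := by
  have h : ∑ x : M.scope a → Fin q with x i = k, M.factorWeight m a x =
      M.varMessage m i a k * M.plainUpdate m (edge a i, k) := by
    rw [plainUpdate_eq, Finset.mul_sum]
    refine Finset.sum_congr rfl fun x hx => ?_
    rw [factorWeight_eq_mul a i, (Finset.mem_filter.mp hx).2]
  rw [h, plainUpdate_eq_of_fixed hpos hfix, varWeight_eq_mul a i]
  ring

theorem sum_fiber {β : Type*} [AddCommMonoid β] (a : F) (i : M.scope a)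
    (f : (M.scope a → Fin q) → β) :
    ∑ k, ∑ x : M.scope a → Fin q with x i = k, f x = ∑ x, f x :=
  Finset.sum_fiberwise _ _ _

theorem partition_eq (hpos : ∀ p, 0 < m p) (hfix : M.normUpdate m = m) (a : F) (i : M.scope a) :
    ∑ x, M.factorWeight m a x = M.Zmess m (edge a i) * ∑ k, M.varWeight m i k := by
  rw [← sum_fiber a i, Finset.mul_sum]
  exact Finset.sum_congr rfl fun k _ => sum_factorWeight_eq hpos hfix a i k

/-- At a fixed point the marginals of the factor beliefs are the variable beliefs. -/
theorem sum_factorBelief_eq (hpos : ∀ p, 0 < m p) (hfix : M.normUpdate m = m) (a : F)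
    (i : M.scope a) (k : Fin q) :
    ∑ x : M.scope a → Fin q with x i = k, M.factorBelief m a x = M.varBelief m i k := by
  have : Nonempty (Fin q) := ⟨k⟩
  simp only [factorBelief_eq, ← Finset.sum_div]
  rw [sum_factorWeight_eq hpos hfix, partition_eq hpos hfix a i, varBelief_eq,
    mul_div_mul_left _ _ (Zmess_pos hpos _).ne']

theorem factorBelief_div_varBelief (hpos : ∀ p, 0 < m p) (hfix : M.normUpdate m = m) (a : F)
    (i : M.scope a) (x : M.scope a → Fin q) :
    M.factorBelief m a x / M.varBelief m i (x i) =
      M.cavityWeight m a i x / M.plainUpdate m (edge a i, x i) := by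
  have : Nonempty (Fin q) := ⟨x i⟩
  have h1 : 0 < ∑ k, M.varWeight m i k :=
    Finset.sum_pos (fun _ _ => varWeight_pos hpos _ _) Finset.univ_nonempty
  have h2 := Zmess_pos hpos (edge a i)
  have h3 := varMessage_pos hpos i a (x i)
  have h4 := hpos (edge a i, x i)
  rw [factorBelief_eq, varBelief_eq, partition_eq hpos hfix a i,
    plainUpdate_eq_of_fixed hpos hfix, factorWeight_eq_mul a i, varWeight_eq_mul a i]
  field_simp

/-- The factor `n_{i → a}(k)` cancels in the quotient of beliefs. What remains is the share of the
terms with `x_j = l` in `Θ_{ai,k}`, the coefficient needed for its logarithmic derivative. -/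
theorem condBelief_eq (hpos : ∀ p, 0 < m p) (hfix : M.normUpdate m = m) (a : F)
    (i j : M.scope a) (k l : Fin q) :
    M.condBelief m a i j k l = (∑ x : M.scope a → Fin q with x i = k ∧ x j = l,
      M.cavityWeight m a i x) / M.plainUpdate m (edge a i, k) := by
  rw [Finset.sum_div]
  refine Finset.sum_congr rfl fun x hx => ?_
  obtain ⟨h1, -⟩ := (Finset.mem_filter.mp hx).2
  rw [← h1]
  exact factorBelief_div_varBelief hpos hfix a i x

theorem varBelief_mul_condBelief (hpos : ∀ p, 0 < m p) (a : F) (i j : M.scope a) (k l : Fin q) :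
    M.varBelief m i k * M.condBelief m a i j k l =
      ∑ x : M.scope a → Fin q with x i = k ∧ x j = l, M.factorBelief m a x := by
  simp only [condBelief, Matrix.of_apply, ← Finset.sum_div]
  exact mul_div_cancel₀ _ (varBelief_pos hpos i k).ne'

/-- Both sides are the pair marginal of `b_a` at `(k, l)`. -/
theorem detailed_balance (hpos : ∀ p, 0 < m p) (a : F) (i j : M.scope a) (k l : Fin q) :
    M.varBelief m i k * M.condBelief m a i j k l =
      M.varBelief m j l * M.condBelief m a j i l k := by
  rw [varBelief_mul_condBelief hpos, varBelief_mul_condBelief hpos]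
  simp only [and_comm]

theorem condBelief_nonneg (hpos : ∀ p, 0 < m p) (a : F) (i j : M.scope a) (k l : Fin q) :
    0 ≤ M.condBelief m a i j k l :=
  Finset.sum_nonneg fun _ _ => (div_pos (factorBelief_pos hpos _ _) (varBelief_pos hpos _ _)).le

theorem condBelief_pos (hpos : ∀ p, 0 < m p) {a : F} {i j : M.scope a} (hij : i ≠ j)
    (k l : Fin q) : 0 < M.condBelief m a i j k l :=
  Finset.sum_pos (fun _ _ => div_pos (factorBelief_pos hpos _ _) (varBelief_pos hpos _ _))
    ⟨fun t => if t = i then k else l, by simp [hij.symm]⟩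

theorem sum_sum_fiber {β : Type*} [AddCommMonoid β] (a : F) (i j : M.scope a) (k : Fin q)
    (f : (M.scope a → Fin q) → β) :
    ∑ l, ∑ x : M.scope a → Fin q with x i = k ∧ x j = l, f x =
      ∑ x : M.scope a → Fin q with x i = k, f x := by
  rw [← Finset.sum_fiberwise (Finset.univ.filter fun x : M.scope a → Fin q => x i = k)
    (fun x => x j)]
  simp only [Finset.filter_filter]

theorem sum_condBelief (hpos : ∀ p, 0 < m p) (hfix : M.normUpdate m = m) (a : F)
    (i j : M.scope a) (k : Fin q) : ∑ l, M.condBelief m a i j k l = 1 := by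
  refine mul_left_cancel₀ (varBelief_pos hpos i k).ne' ?_
  rw [Finset.mul_sum, mul_one]
  simp only [varBelief_mul_condBelief hpos]
  rw [sum_sum_fiber, sum_factorBelief_eq hpos hfix]

theorem condBelief_mulVec_one (hpos : ∀ p, 0 < m p) (hfix : M.normUpdate m = m) (a : F)
    (i j : M.scope a) : M.condBelief m a i j *ᵥ 1 = 1 := by
  ext k
  simp [Matrix.mulVec, dotProduct, sum_condBelief hpos hfix a i j k]

theorem varBelief_vecMul_condBelief (hpos : ∀ p, 0 < m p) (hfix : M.normUpdate m = m) (a : F)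
    (i j : M.scope a) : M.varBelief m i ᵥ* M.condBelief m a i j = M.varBelief m j := by
  ext l
  simp only [Matrix.vecMul, dotProduct, detailed_balance hpos a i j, ← Finset.mul_sum,
    sum_condBelief hpos hfix a j i l, mul_one]

end MarkovField

end

/-! ### The Jacobian in logarithmic coordinates and its centering. -/

section

theorem hasDerivAt_prod_log {ι : Type*} [DecidableEq ι] (S : Finset ι) {g : ι → ℝ → ℝ}
    {u : ι → ℝ} {t : ℝ} (h : ∀ s ∈ S, HasDerivAt (g s) (g s t * u s) t) :
    HasDerivAt (fun y => ∏ s ∈ S, g s y) ((∏ s ∈ S, g s t) * ∑ s ∈ S, u s) t := by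
  induction S using Finset.induction_on with
  | empty => simpa using hasDerivAt_const t (1 : ℝ)
  | insert a S ha ih =>
    simp only [Finset.prod_insert ha, Finset.sum_insert ha]
    exact ((h a (Finset.mem_insert_self a S)).fun_mul
      (ih fun s hs => h s (Finset.mem_insert_of_mem hs))).congr_deriv (by ring)

variable {V F : Type*} [Fintype V] [DecidableEq V] [Fintype F] [DecidableEq F] {q : ℕ}

namespace MarkovField

open scoped Matrix

variable {M : MarkovField V F q} {m : M.Messages}

theorem contDiff_plainUpdate (p : M.Edge × Fin q) (n : WithTop ℕ∞) :
    ContDiff ℝ n fun y => M.plainUpdate y p := by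
  unfold plainUpdate varMessage
  refine ContDiff.sum fun x _ => contDiff_const.mul (contDiff_prod fun j _ =>
    contDiff_const.mul (contDiff_prod fun e _ => ?_))
  exact contDiff_apply ℝ ℝ _

theorem contDiffAt_normUpdate (hpos : ∀ p, 0 < m p) (n : WithTop ℕ∞) :
    ContDiffAt ℝ n M.normUpdate m := by
  refine contDiffAt_pi.mpr fun p => ?_
  have : Nonempty (Fin q) := ⟨p.2⟩
  unfold normUpdate Zmess
  exact (contDiff_plainUpdate p n).contDiffAt.div
    (ContDiff.sum fun k _ => contDiff_plainUpdate _ n).contDiffAt (Zmess_pos hpos p.1).ne'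

/-- The matrix `B^{(iaj)}` attached to the edges `ai` and `a'j`, when `j ∈ a`. -/
noncomputable def edgeBelief (M : MarkovField V F q) (m : M.Messages) (e f : M.Edge) :
    Matrix (Fin q) (Fin q) ℝ :=
  if h : f.1.2 ∈ M.scope e.1.1 then M.condBelief m e.1.1 ⟨e.1.2, e.2⟩ ⟨f.1.2, h⟩ else 0

/-- The Jacobian matrix of the plain update in logarithmic coordinates. -/
noncomputable def logJacobian (M : MarkovField V F q) (m : M.Messages) :
    Matrix (M.Edge × Fin q) (M.Edge × Fin q) ℝ :=
  Matrix.of fun p r => M.lineAdj p.1 r.1 * M.edgeBelief m p.1 r.1 p.2 r.2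

/-- The Jacobian matrix in logarithmic coordinates, acting on functions modulo constants. -/
noncomputable def centeredJacobian (M : MarkovField V F q) (m : M.Messages) :
    Matrix (M.Edge × Fin q) (M.Edge × Fin q) ℝ :=
  Matrix.of fun p r => M.lineAdj p.1 r.1 *
    (M.edgeBelief m p.1 r.1 p.2 r.2 - M.varBelief m r.1.1.2 r.2)

/-- Averaging against the messages on each edge. -/
noncomputable def messageMean (M : MarkovField V F q) (m : M.Messages) :
    Matrix (M.Edge × Fin q) (M.Edge × Fin q) ℝ :=
  Matrix.of fun p r => if p.1 = r.1 then m r else 0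

/-- Each edge `a'j` determines its variable `j`, so the double sum over `j` and the edges at `j` is
a single sum over edges, selected by `A`. -/
theorem sum_neighbours (e : M.Edge) (x : M.scope e.1.1 → Fin q) (g : M.Edge × Fin q → ℝ) :
    ∑ j : M.scope e.1.1 with j ≠ ⟨e.1.2, e.2⟩, ∑ f : M.Edge with f.1.2 = (j : V) ∧ f.1.1 ≠ e.1.1,
        g (f, x j) =
      ∑ f : M.Edge, M.lineAdj e f *
        if h : f.1.2 ∈ M.scope e.1.1 then g (f, x ⟨f.1.2, h⟩) else 0 := by
  simp only [Finset.sum_filter]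
  have : ∀ j : M.scope e.1.1,
      (if j ≠ ⟨e.1.2, e.2⟩ then ∑ f : M.Edge, if f.1.2 = (j : V) ∧ f.1.1 ≠ e.1.1 then g (f, x j) else 0
        else 0) =
      ∑ f : M.Edge, if j ≠ ⟨e.1.2, e.2⟩ ∧ f.1.2 = (j : V) ∧ f.1.1 ≠ e.1.1 then g (f, x j) else 0 := by
    intro j
    by_cases hj : j = ⟨e.1.2, e.2⟩ <;> simp [hj]
  simp only [this]
  rw [Finset.sum_comm]
  refine Finset.sum_congr rfl fun f _ => ?_
  by_cases h : f.1.2 ∈ M.scope e.1.1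
  · rw [dif_pos h, Finset.sum_eq_single ⟨f.1.2, h⟩]
    · by_cases h1 : f.1.2 = e.1.2 <;> by_cases h2 : f.1.1 = e.1.1 <;>
        simp [lineAdj, h, h1, h2]
    · intro j _ hj
      rw [if_neg]
      rintro ⟨-, h1, -⟩
      exact hj (Subtype.ext h1.symm)
    · simp
  · rw [dif_neg h, mul_zero]
    refine Finset.sum_eq_zero fun j _ => if_neg ?_
    rintro ⟨-, h1, -⟩
    exact h (h1 ▸ j.2)

theorem logJacobian_mulVec (hpos : ∀ p, 0 < m p) (hfix : M.normUpdate m = m)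
    (e : M.Edge) (k : Fin q) (g : M.Edge × Fin q → ℝ) :
    ∑ x : M.scope e.1.1 → Fin q with x ⟨e.1.2, e.2⟩ = k,
        M.cavityWeight m e.1.1 ⟨e.1.2, e.2⟩ x *
          ∑ j : M.scope e.1.1 with j ≠ ⟨e.1.2, e.2⟩,
            ∑ f : M.Edge with f.1.2 = (j : V) ∧ f.1.1 ≠ e.1.1, g (f, x j) =
      M.plainUpdate m (e, k) * (M.logJacobian m *ᵥ g) (e, k) := by
  simp only [sum_neighbours, Matrix.mulVec, dotProduct, logJacobian, Matrix.of_apply,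
    Fintype.sum_prod_type, Finset.mul_sum]
  rw [Finset.sum_comm]
  refine Finset.sum_congr rfl fun f _ => ?_
  by_cases h : f.1.2 ∈ M.scope e.1.1
  · simp only [dif_pos h, edgeBelief]
    rw [← sum_sum_fiber e.1.1 ⟨e.1.2, e.2⟩ ⟨f.1.2, h⟩ k]
    refine Finset.sum_congr rfl fun l _ => ?_
    have hp := (plainUpdate_pos (M := M) hpos (e, k)).ne'
    have hc := condBelief_eq (M := M) hpos hfix e.1.1 ⟨e.1.2, e.2⟩ ⟨f.1.2, h⟩ k l
    rw [eq_div_iff hp] at hc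
    calc _ = (∑ x : M.scope e.1.1 → Fin q with x ⟨e.1.2, e.2⟩ = k ∧ x ⟨f.1.2, h⟩ = l,
            M.cavityWeight m e.1.1 ⟨e.1.2, e.2⟩ x) * (M.lineAdj e f * g (f, l)) := by
          rw [Finset.sum_mul]
          refine Finset.sum_congr rfl fun x hx => ?_
          rw [(Finset.mem_filter.mp hx).2.2]
      _ = _ := by
          rw [← hc]
          ring
  · simp [dif_neg h, edgeBelief]

theorem hasDerivAt_plainUpdate (hpos : ∀ p, 0 < m p) (hfix : M.normUpdate m = m)
    (v : M.Edge × Fin q → ℝ) (p : M.Edge × Fin q) :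
    HasDerivAt (fun t : ℝ => M.plainUpdate (m + t • v) p)
      (M.plainUpdate m p * (M.logJacobian m *ᵥ fun r => v r / m r) p) 0 := by
  obtain ⟨e, k⟩ := p
  rw [← logJacobian_mulVec hpos hfix e k]
  unfold plainUpdate
  refine HasDerivAt.fun_sum fun x _ => ?_
  have hcoord : ∀ r, HasDerivAt (fun t : ℝ => (m + t • v) r)
      ((m + (0 : ℝ) • v) r * (v r / m r)) 0 := by
    intro r
    have h := ((hasDerivAt_id (0 : ℝ)).mul_const (v r)).const_add (m r)
    refine h.congr_deriv ?_
    have := (hpos r).ne'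
    simp only [zero_smul, add_zero, one_mul]
    field_simp
  have hvar : ∀ j : M.scope e.1.1, HasDerivAt
      (fun t : ℝ => M.varMessage (m + t • v) j e.1.1 (x j))
      (M.varMessage (m + (0 : ℝ) • v) j e.1.1 (x j) *
        ∑ f : M.Edge with f.1.2 = (j : V) ∧ f.1.1 ≠ e.1.1, v (f, x j) / m (f, x j)) 0 := by
    intro j
    have h := (hasDerivAt_prod_log (Finset.univ.filter fun f : M.Edge => f.1.2 = (j : V) ∧ f.1.1 ≠ e.1.1)
      (g := fun f t => (m + t • v) (f, x j)) (u := fun f => v (f, x j) / m (f, x j))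
      (t := 0) fun f _ => hcoord _).const_mul (M.phi j (x j))
    rw [← mul_assoc] at h
    exact h
  have h := (hasDerivAt_prod_log
    (Finset.univ.filter fun j : M.scope e.1.1 => j ≠ ⟨e.1.2, e.2⟩)
    (g := fun j t => M.varMessage (m + t • v) j e.1.1 (x j)) (t := 0)
    fun j _ => hvar j).const_mul (M.psi e.1.1 x)
  rw [← mul_assoc, zero_smul, add_zero] at h
  exact h

theorem hasDerivAt_normUpdate (hpos : ∀ p, 0 < m p) (hfix : M.normUpdate m = m)
    (v : M.Edge × Fin q → ℝ) (p : M.Edge × Fin q) :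
    HasDerivAt (fun t : ℝ => M.normUpdate (m + t • v) p)
      (m p * (((1 - M.messageMean m) * M.logJacobian m) *ᵥ fun r => v r / m r) p) 0 := by
  have : Nonempty (Fin q) := ⟨p.2⟩
  have hZ := (Zmess_pos hpos p.1).ne'
  have hnum := hasDerivAt_plainUpdate hpos hfix v p
  have hden : HasDerivAt (fun t : ℝ => M.Zmess (m + t • v) p.1)
      (∑ k, M.plainUpdate m (p.1, k) * (M.logJacobian m *ᵥ fun r => v r / m r) (p.1, k)) 0 :=
    HasDerivAt.fun_sum fun k _ => hasDerivAt_plainUpdate hpos hfix v (p.1, k)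
  -- Since `Θ = Z^mess m`, the logarithmic derivative of `Z^mess` is the mean of that of `Θ` against
  -- the messages, whence the factor `1 - messageMean`.
  have h := hnum.fun_div hden (by simpa using hZ)
  simp only [zero_smul, add_zero, plainUpdate_eq_of_fixed hpos hfix] at h
  unfold normUpdate
  refine h.congr_deriv ?_
  set g := M.logJacobian m *ᵥ fun r => v r / m r
  have hmean : (M.messageMean m *ᵥ g) p = ∑ k, m (p.1, k) * g (p.1, k) := by
    simp only [Matrix.mulVec, dotProduct, messageMean, Matrix.of_apply, Fintype.sum_prod_type]
    rw [Finset.sum_eq_single p.1 (fun f _ hf => by simp [hf.symm]) (by simp)]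
    simp
  have hsum : ∑ k, M.Zmess m p.1 * m (p.1, k) * g (p.1, k) =
      M.Zmess m p.1 * ∑ k, m (p.1, k) * g (p.1, k) := by
    rw [Finset.mul_sum]
    exact Finset.sum_congr rfl fun k _ => mul_assoc _ _ _
  rw [hsum, ← Matrix.mulVec_mulVec, Matrix.sub_mulVec, Matrix.one_mulVec, Pi.sub_apply, hmean]
  field_simp
  ring

theorem toMatrix_fderiv_normUpdate (hpos : ∀ p, 0 < m p) (hfix : M.normUpdate m = m) :
    LinearMap.toMatrix' (fderiv ℝ M.normUpdate m).toLinearMap =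
      Matrix.diagonal m * ((1 - M.messageMean m) * M.logJacobian m) *
        Matrix.diagonal fun r => (m r)⁻¹ := by
  have hd := (contDiffAt_normUpdate (M := M) hpos 1).differentiableAt one_ne_zero
  ext p r
  rw [LinearMap.toMatrix'_apply, Matrix.mul_diagonal, Matrix.diagonal_mul]
  have h1 := hasDerivAt_pi.mp (hd.hasFDerivAt.hasLineDerivAt (Pi.single r 1)) p
  refine (h1.unique (hasDerivAt_normUpdate hpos hfix (Pi.single r 1) p)).trans ?_
  have h2 : (fun s => (Pi.single r (1 : ℝ) : M.Edge × Fin q → ℝ) s / m s) =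
      Pi.single r (m r)⁻¹ := by
    ext s
    by_cases hs : s = r
    · subst hs
      simp
    · simp [hs]
  rw [h2, Matrix.mulVec_single]
  simp [mul_assoc]

/-- The two Jacobians differ by `A_{ai}^{a'j} b_j(l)`, which does not depend on `k`. As messages sum
to `1`, averaging fixes such columns and `1 - messageMean` kills them. -/
theorem messageMean_mul_sub [Nonempty (Fin q)] (hpos : ∀ p, 0 < m p)
    (hfix : M.normUpdate m = m) :
    (1 - M.messageMean m) * M.logJacobian m = (1 - M.messageMean m) * M.centeredJacobian m := by
  rw [← sub_eq_zero, ← mul_sub]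
  have h : M.messageMean m * (M.logJacobian m - M.centeredJacobian m) =
      M.logJacobian m - M.centeredJacobian m := by
    ext p r
    simp only [Matrix.mul_apply, messageMean, Matrix.of_apply, Matrix.sub_apply, logJacobian,
      centeredJacobian, Fintype.sum_prod_type]
    rw [Finset.sum_eq_single p.1 (fun f _ hf => by simp [hf.symm]) (by simp)]
    simp only [if_true, mul_sub, sub_sub_cancel]
    rw [← Finset.sum_mul, sum_messages_eq_one hpos hfix, one_mul]
  rw [sub_mul, one_mul, h, sub_self]

theorem sum_edgeBelief (hpos : ∀ p, 0 < m p) (hfix : M.normUpdate m = m) (e f : M.Edge)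
    (k : Fin q) : M.lineAdj e f * ∑ l, M.edgeBelief m e f k l = M.lineAdj e f := by
  by_cases h : f.1.2 ∈ M.scope e.1.1
  · simp only [edgeBelief, dif_pos h, sum_condBelief hpos hfix, mul_one]
  · simp [lineAdj, h]

/-- The rows of each centered block sum to zero, so functions constant on edges are annihilated.
With `matrixRadius_mul_comm` this removes the projection from the spectral radius. -/
theorem centeredJacobian_mul [Nonempty (Fin q)] (hpos : ∀ p, 0 < m p)
    (hfix : M.normUpdate m = m) :
    M.centeredJacobian m * (1 - M.messageMean m) = M.centeredJacobian m := by
  have h : M.centeredJacobian m * M.messageMean m = 0 := by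
    ext p r
    simp only [Matrix.mul_apply, messageMean, Matrix.of_apply, centeredJacobian,
      Fintype.sum_prod_type, Matrix.zero_apply]
    rw [Finset.sum_eq_single r.1 (fun f _ hf => by simp [hf]) (by simp)]
    simp only [if_true]
    rw [← Finset.sum_mul, ← Finset.mul_sum, Finset.sum_sub_distrib, mul_sub,
      sum_edgeBelief hpos hfix, sum_varBelief hpos, mul_one, sub_self, zero_mul]
  rw [mul_sub, h, mul_one, sub_zero]

/-- The Jacobian matrix of the normalized update has the spectral radius of `centeredJacobian`. -/
theorem matrixRadius_fderiv_normUpdate [Nonempty (Fin q)] (hpos : ∀ p, 0 < m p)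
    (hfix : M.normUpdate m = m) :
    matrixRadius (LinearMap.toMatrix' (fderiv ℝ M.normUpdate m).toLinearMap) =
      matrixRadius (M.centeredJacobian m) := by
  rw [toMatrix_fderiv_normUpdate hpos hfix, matrixRadius_diagonal_conj fun p => (hpos p).ne',
    messageMean_mul_sub hpos hfix, matrixRadius_mul_comm, centeredJacobian_mul hpos hfix]

end MarkovField

end

/-! ### Reversible kernels between two weighted spaces. -/

section

section Reversible

open scoped Matrix

variable {q : ℕ} {C C' : Matrix (Fin q) (Fin q) ℝ} {w w' : Fin q → ℝ}

/-- Conjugation by square roots of the weights turns the weighted `L²` adjoint into the transpose.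
-/
theorem transpose_sqrt_conj (hw : ∀ k, 0 < w k) (hw' : ∀ k, 0 < w' k)
    (hb : ∀ k l, w k * C k l = w' l * C' l k) :
    (Matrix.diagonal (fun k => √(w k)) * C * Matrix.diagonal fun k => (√(w' k))⁻¹)ᵀ =
      Matrix.diagonal (fun k => √(w' k)) * C' * Matrix.diagonal fun k => (√(w k))⁻¹ := by
  ext l k
  simp only [Matrix.transpose_apply, Matrix.mul_diagonal, Matrix.diagonal_mul]
  have h1 := (Real.sqrt_pos.mpr (hw k)).ne'
  have h2 := (Real.sqrt_pos.mpr (hw' l)).ne'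
  field_simp
  rw [Real.sq_sqrt (hw k).le, Real.sq_sqrt (hw' l).le]
  exact hb k l

theorem sqrt_conj_mul (hw : ∀ k, 0 < w k) :
    (Matrix.diagonal (fun k => √(w' k)) * C' * Matrix.diagonal fun k => (√(w k))⁻¹) *
      (Matrix.diagonal (fun k => √(w k)) * C * Matrix.diagonal fun k => (√(w' k))⁻¹) =
      Matrix.diagonal (fun k => √(w' k)) * (C' * C) * Matrix.diagonal fun k => (√(w' k))⁻¹ := by
  have h := diagonal_inv_mul_diagonal (d := fun k => √(w k))
    fun k => (Real.sqrt_pos.mpr (hw k)).ne'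
  calc _ = Matrix.diagonal (fun k => √(w' k)) * C' *
        ((Matrix.diagonal fun k => (√(w k))⁻¹) * Matrix.diagonal fun k => √(w k)) * C *
          Matrix.diagonal fun k => (√(w' k))⁻¹ := by simp only [mul_assoc]
    _ = _ := by rw [h, mul_one]; simp only [mul_assoc]

open scoped Matrix.Norms.L2Operator in
/-- The norm of a stochastic kernel `C` between mean zero functions is the square root of the
second largest eigenvalue of `C' * C`, where `C'` is the reversed kernel. -/
theorem norm_sq_sqrt_conj_centered (hC : C *ᵥ 1 = 1) (hC' : C' *ᵥ 1 = 1)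
    (hn : ∀ k l, 0 ≤ C k l) (hn' : ∀ k l, 0 ≤ C' k l)
    (hw : ∀ k, 0 < w k) (hw' : ∀ k, 0 < w' k) (hw1 : ∑ k, w k = 1) (hw1' : ∑ k, w' k = 1)
    (hb : ∀ k l, w k * C k l = w' l * C' l k) (hwC : w ᵥ* C = w') :
    ‖(Matrix.diagonal (fun k => √(w k)) * (C - Matrix.vecMulVec 1 w') *
      Matrix.diagonal fun k => (√(w' k))⁻¹).map (algebraMap ℝ ℂ)‖ ^ 2 =
        secondEigenvalue (C' * C) := by
  have hd : ∀ k, √(w' k) ≠ 0 := fun k => (Real.sqrt_pos.mpr (hw' k)).ne'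
  -- Centering commutes with composition because `C'` preserves constants and `C` carries `w` to
  -- `w'`.
  have hcent : (C' - Matrix.vecMulVec 1 w) * (C - Matrix.vecMulVec 1 w') =
      C' * C - Matrix.vecMulVec 1 w' := by
    have h1 : w ⬝ᵥ 1 = 1 := by simpa [dotProduct] using hw1
    rw [sub_mul, mul_sub, mul_sub, Matrix.mul_vecMulVec, Matrix.vecMulVec_mul, hC', hwC,
      Matrix.mul_vecMulVec, Matrix.vecMulVec_mulVec, h1]
    simp
  have hb' : ∀ k l, w k * (C - Matrix.vecMulVec 1 w' : Matrix (Fin q) (Fin q) ℝ) k l =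
      w' l * (C' - Matrix.vecMulVec 1 w : Matrix (Fin q) (Fin q) ℝ) l k := fun k l => by
    simp only [Matrix.sub_apply, Matrix.vecMulVec_apply, Pi.one_apply, mul_sub, hb k l]
    ring
  have hroots : ∀ t ∈ (C' * C).charpoly.roots, 0 ≤ t := fun t ht => by
    refine nonneg_of_mem_roots_charpoly_transpose_mul_self
      (Matrix.diagonal (fun k => √(w k)) * C * Matrix.diagonal fun k => (√(w' k))⁻¹) ?_
    rwa [transpose_sqrt_conj hw hw' hb, sqrt_conj_mul hw, charpoly_diagonal_conj hd]
  rw [sq, l2_opNorm_map_sq, transpose_sqrt_conj hw hw' hb', sqrt_conj_mul hw, hcent,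
    matrixRadius_diagonal_conj hd, secondEigenvalue_eq_secondEigenvalueAbs hroots]
  refine (secondEigenvalueAbs_eq_matrixRadius ?_ ?_ hw' hw1' ?_).symm
  · rw [← Matrix.mulVec_mulVec, hC, hC']
  · intro k l
    rw [Matrix.mul_apply]
    exact Finset.sum_nonneg fun t _ => mul_nonneg (hn' k t) (hn t l)
  · intro k l
    simp only [Matrix.mul_apply, Finset.mul_sum, ← mul_assoc, ← hb]
    exact Finset.sum_congr rfl fun t _ => by ring

/-- Detailed balance with positive entries prescribes all ratios `w k / w l`, and the total mass
fixes the scale. -/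
theorem eq_of_detailed_balance {B : Matrix (Fin q) (Fin q) ℝ} (hB : ∀ k l, 0 < B k l)
    (hw : ∀ k l, w k * B k l = w l * B l k) (hw' : ∀ k l, w' k * B k l = w' l * B l k)
    (hw1 : ∑ k, w k = 1) (hw1' : ∑ k, w' k = 1) : w = w' := by
  have h : ∀ k l, w k * w' l = w' k * w l := fun k l => by
    refine mul_right_cancel₀ (hB k l).ne' ?_
    linear_combination w' l * hw k l - w l * hw' k l
  ext k
  calc w k = ∑ l, w k * w' l := by rw [← Finset.mul_sum, hw1', mul_one]
    _ = ∑ l, w' k * w l := Finset.sum_congr rfl fun l _ => h k l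
    _ = w' k := by rw [← Finset.mul_sum, hw1, mul_one]

end Reversible

variable {V F : Type*} [Fintype V] [DecidableEq V] [Fintype F] [DecidableEq F] {q : ℕ}

/-! ### Spectral radius of the Jacobian in the general and homogeneous cases. -/

namespace MarkovField

open scoped Matrix

variable {M : MarkovField V F q} {m : M.Messages}

theorem mu2_nonneg : 0 ≤ M.mu2 m := Real.iSup_nonneg fun _ => Real.sqrt_nonneg _

theorem sqrt_secondEigenvalue_le_mu2 {a : F} {i j : M.scope a} (hij : i ≠ j) :
    √|secondEigenvalue (M.condBelief m a i j * M.condBelief m a j i)| ≤ M.mu2 m :=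
  le_ciSup (f := fun p : (a : F) × {p : M.scope a × M.scope a // p.1 ≠ p.2} =>
    √|secondEigenvalue
      (M.condBelief m p.1 p.2.1.1 p.2.1.2 * M.condBelief m p.1 p.2.1.2 p.2.1.1)|)
    (Set.finite_range _).bddAbove ⟨a, ⟨(i, j), hij⟩⟩

theorem lineAdj_eq_one_or_zero (e f : M.Edge) :
    (f.1.2 ∈ M.scope e.1.1 ∧ f.1.2 ≠ e.1.2 ∧ M.lineAdj e f = 1) ∨ M.lineAdj e f = 0 := by
  by_cases h : f.1.2 ∈ M.scope e.1.1 ∧ f.1.2 ≠ e.1.2 ∧ f.1.1 ≠ e.1.1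
  · exact Or.inl ⟨h.1, h.2.1, if_pos h⟩
  · exact Or.inr (if_neg h)

open scoped Matrix.Norms.L2Operator in
theorem norm_centered_le_mu2 (hpos : ∀ p, 0 < m p) (hfix : M.normUpdate m = m) {a : F}
    {i j : M.scope a} (hij : i ≠ j) :
    ‖(Matrix.diagonal (fun k => √(M.varBelief m i k)) *
      (M.condBelief m a i j - Matrix.vecMulVec 1 (M.varBelief m j)) *
        Matrix.diagonal fun k => (√(M.varBelief m j k))⁻¹).map (algebraMap ℝ ℂ)‖ ≤ M.mu2 m := by
  rcases isEmpty_or_nonempty (Fin q) with hq | hq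
  · refine le_trans (le_of_eq ?_) mu2_nonneg
    rw [norm_eq_zero]
    exact Subsingleton.elim _ _
  have h := norm_sq_sqrt_conj_centered (condBelief_mulVec_one hpos hfix a i j)
    (condBelief_mulVec_one hpos hfix a j i) (condBelief_nonneg hpos a i j)
    (condBelief_nonneg hpos a j i) (varBelief_pos hpos i) (varBelief_pos hpos j)
    (sum_varBelief hpos i) (sum_varBelief hpos j) (detailed_balance hpos a i j)
    (varBelief_vecMul_condBelief hpos hfix a i j)
  -- The pair is swapped because the adjoint stands on the left: the relevant kernel is `K^{(jai)} =
  -- B^{(jai)} B^{(iaj)}`.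
  refine le_trans ?_ (sqrt_secondEigenvalue_le_mu2 hij.symm)
  rw [← h]
  exact Real.le_sqrt_of_sq_le (le_abs_self _)

open scoped Matrix.Norms.L2Operator in
theorem matrixRadius_centeredJacobian_lt_one (hpos : ∀ p, 0 < m p) (hfix : M.normUpdate m = m)
    (h : M.perron * M.mu2 m < 1) : matrixRadius (M.centeredJacobian m) < 1 := by
  have hd : ∀ p : M.Edge × Fin q, √(M.varBelief m p.1.1.2 p.2) ≠ 0 := fun p =>
    (Real.sqrt_pos.mpr (varBelief_pos hpos _ _)).ne'
  -- After conjugation by `√b_i`, ordinary `L²` norms of blocks are norms from `L²(b_j)` to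
  -- `L²(b_i)`. The weight depends only on the variable of the edge, so it fits every block in its
  -- row and column.
  rw [← matrixRadius_diagonal_conj hd]
  refine matrixRadius_lt_one_of_norm_block_le mu2_nonneg h fun e f => ?_
  rcases lineAdj_eq_one_or_zero e f with ⟨h1, h2, h3⟩ | h0
  · have hne : (⟨e.1.2, e.2⟩ : M.scope e.1.1) ≠ ⟨f.1.2, h1⟩ := fun heq =>
      h2 (congrArg Subtype.val heq).symm
    rw [h3, mul_one]
    refine le_trans (le_of_eq ?_) (norm_centered_le_mu2 hpos hfix hne)
    congr 1
    ext k l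
    simp [centeredJacobian, edgeBelief, h1, h3, Matrix.mul_diagonal, Matrix.diagonal_mul]
  · rw [h0, mul_zero]
    refine le_of_eq ((congrArg norm (Matrix.ext fun k l => ?_)).trans norm_zero)
    simp [centeredJacobian, h0, Matrix.mul_diagonal, Matrix.diagonal_mul]

theorem Homogeneous.reversible {B : Matrix (Fin q) (Fin q) ℝ} (hB : M.Homogeneous m B)
    (hpos : ∀ p, 0 < m p) {a : F} {i j : M.scope a} (hij : i ≠ j) (k l : Fin q) :
    M.varBelief m j k * B k l = M.varBelief m j l * B l k := by
  have h1 := detailed_balance hpos a i j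
  have hpB := condBelief_pos hpos hij
  rw [hB a i j hij] at h1 hpB
  rw [hB a j i hij.symm] at h1
  -- Equal kernels in both directions force equal beliefs, by detailed balance on the diagonal,
  -- where `B k k > 0`.
  have h2 : M.varBelief m i k = M.varBelief m j k := mul_right_cancel₀ (hpB k k).ne' (h1 k k)
  rw [← h2, h1]

open Kronecker in
theorem Homogeneous.matrixRadius_centeredJacobian [Nonempty (Fin q)]
    {B : Matrix (Fin q) (Fin q) ℝ} (hB : M.Homogeneous m B) (hpos : ∀ p, 0 < m p)
    (hfix : M.normUpdate m = m) :
    matrixRadius (M.centeredJacobian m) = M.perron * secondEigenvalueAbs B := by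
  -- Without two linked edges nothing may constrain `B`, but then both sides vanish.
  by_cases hA : M.lineAdj = 0
  · have h0 : M.centeredJacobian m = 0 := by
      ext p r
      simp [centeredJacobian, hA]
    rw [h0, perron, hA, matrixRadius_zero, matrixRadius_zero, zero_mul]
  obtain ⟨e₀, f₀, h₀⟩ : ∃ e f, M.lineAdj e f ≠ 0 := by
    by_contra hcon
    push Not at hcon
    exact hA (Matrix.ext hcon)
  obtain ⟨hm₀, hne₀, -⟩ := (lineAdj_eq_one_or_zero e₀ f₀).resolve_right h₀
  have hij : ∀ {e f : M.Edge} (h1 : f.1.2 ∈ M.scope e.1.1), f.1.2 ≠ e.1.2 →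
      (⟨e.1.2, e.2⟩ : M.scope e.1.1) ≠ ⟨f.1.2, h1⟩ := fun h1 h2 heq =>
    h2 (congrArg Subtype.val heq).symm
  have hc := hB _ _ _ (hij hm₀ hne₀)
  have hBpos : ∀ k l, 0 < B k l := hc ▸ condBelief_pos hpos (hij hm₀ hne₀)
  have hB1 : B *ᵥ 1 = 1 := hc ▸ condBelief_mulVec_one hpos hfix _ _ _
  have hrev := hB.reversible hpos (hij hm₀ hne₀)
  have hker : M.centeredJacobian m =
      M.lineAdj ⊗ₖ (B - Matrix.vecMulVec 1 (M.varBelief m f₀.1.2)) := by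
    ext p r
    rw [Matrix.kronecker_apply]
    rcases lineAdj_eq_one_or_zero p.1 r.1 with ⟨h1, h2, -⟩ | h0
    -- Every target belief reverses the same `B`, so all of them coincide and the block no longer
    -- depends on the edges.
    · have heq : M.varBelief m r.1.1.2 = M.varBelief m f₀.1.2 :=
        eq_of_detailed_balance hBpos (hB.reversible hpos (hij h1 h2)) hrev
          (sum_varBelief hpos _) (sum_varBelief hpos _)
      simp only [centeredJacobian, edgeBelief, Matrix.of_apply, dif_pos h1, hB _ _ _ (hij h1 h2),
        heq, Matrix.sub_apply, Matrix.vecMulVec_apply, Pi.one_apply, one_mul]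
    · simp [centeredJacobian, h0]
  rw [hker, matrixRadius_kronecker, perron, secondEigenvalueAbs_eq_matrixRadius hB1
    (fun k l => (hBpos k l).le) (varBelief_pos hpos _) (sum_varBelief hpos _) hrev]

theorem matrixRadius_eq_zero_of_isEmpty [IsEmpty (Fin q)]
    (X : Matrix (M.Edge × Fin q) (M.Edge × Fin q) ℝ) : matrixRadius X = 0 := by
  rw [Subsingleton.elim X 0, matrixRadius_zero]

theorem matrixRadius_jacobian_lt_one (hpos : ∀ p, 0 < m p) (hfix : M.normUpdate m = m)
    (h : M.perron * M.mu2 m < 1) :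
    matrixRadius (LinearMap.toMatrix' (fderiv ℝ M.normUpdate m).toLinearMap) < 1 := by
  rcases isEmpty_or_nonempty (Fin q) with hq | hq
  · rw [matrixRadius_eq_zero_of_isEmpty]
    exact one_pos
  · rw [matrixRadius_fderiv_normUpdate hpos hfix]
    exact matrixRadius_centeredJacobian_lt_one hpos hfix h

theorem Homogeneous.matrixRadius_jacobian {B : Matrix (Fin q) (Fin q) ℝ}
    (hB : M.Homogeneous m B) (hpos : ∀ p, 0 < m p) (hfix : M.normUpdate m = m) :
    matrixRadius (LinearMap.toMatrix' (fderiv ℝ M.normUpdate m).toLinearMap) =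
      M.perron * secondEigenvalueAbs B := by
  -- For `q = 0` there are no coordinates and no eigenvalues, and the default `0` makes both sides
  -- zero.
  rcases isEmpty_or_nonempty (Fin q) with hq | hq
  · rw [matrixRadius_eq_zero_of_isEmpty, secondEigenvalueAbs, Matrix.charpoly_isEmpty]
    simp [secondLargest]
  · rw [matrixRadius_fderiv_normUpdate hpos hfix, hB.matrixRadius_centeredJacobian hpos hfix]

end MarkovField

end

end BP

theorem mainTheorem2 {V F : Type*} [Fintype V] [DecidableEq V] [Fintype F] [DecidableEq F]
    {q : ℕ} (M : BP.MarkovField V F q) (m : M.Messages) (hpos : ∀ p, 0 < m p)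
    (hfix : M.normUpdate m = m) :
    (M.perron * M.mu2 m < 1 →
      BP.LinearlyStable M.normUpdate m ∧ BP.LocallyAsymptoticallyStable M.normUpdate m) ∧
    (∀ B : Matrix (Fin q) (Fin q) ℝ, M.Homogeneous m B →
      (BP.LinearlyStable M.normUpdate m ↔ M.perron * BP.secondEigenvalueAbs B < 1) ∧
      (M.perron * BP.secondEigenvalueAbs B < 1 →
        BP.LocallyAsymptoticallyStable M.normUpdate m) ∧
      (1 < M.perron * BP.secondEigenvalueAbs B → ¬ BP.LyapunovStable M.normUpdate m)) := by
  have hd : DifferentiableAt ℝ M.normUpdate m :=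
    (BP.MarkovField.contDiffAt_normUpdate hpos 1).differentiableAt one_ne_zero
  have hlas : BP.LinearlyStable M.normUpdate m → BP.LocallyAsymptoticallyStable M.normUpdate m :=
    fun h => h.locallyAsymptoticallyStable hfix
  refine ⟨fun h => ?_, fun B hB => ?_⟩
  · have hs : BP.LinearlyStable M.normUpdate m :=
      ⟨hd, BP.MarkovField.matrixRadius_jacobian_lt_one hpos hfix h⟩
    exact ⟨hs, hlas hs⟩
  · have hr := BP.MarkovField.Homogeneous.matrixRadius_jacobian hB hpos hfix
    have hiff : BP.LinearlyStable M.normUpdate m ↔ M.perron * BP.secondEigenvalueAbs B < 1 := by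
      rw [BP.LinearlyStable, hr]
      exact and_iff_right hd
    exact ⟨hiff, fun h => hlas (hiff.mpr h), fun h =>
      BP.not_lyapunovStable_of_one_lt_matrixRadius hfix
        (BP.MarkovField.contDiffAt_normUpdate hpos 2) (hr ▸ h)⟩
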